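/- All groups are finite. Let $p$ be a prime, let $G$ be a finite group, let $N$ be a normal subgroup of $G$ and let $P$ be a Sylow $p$-subgroup of $N$. A subgroup $H$ of $G$ satisfies the $\Pi$-property in $G$ if for every chief factor $L/K$ of $G$ every prime divisor of the index $|G/K : N_{G/K}(HK/K\cap L/K)|$ divides the order of $HK/K\cap L/K$. It satisfies the $IC$-$\Pi$-property in $G$ if $H\cap [H,G]$ satisfies the $\Pi$-property in $G$. The $p\mathfrak{U}$-hypercenter $Z_{p\mathfrak{U}}(G)$ is the product of all normal subgroups $H$ of $G$ such that every chief factor of $G$ below $H$ whose order is divisible by $p$ is cyclic. Suppose that (1) every subgroup of $P$ of order $p$ satisfies the $IC$-$\Pi$-property in $G$; and (2) if $p=2$ and $P$ is non-abelian, then every cyclic subgroup of $P$ of order $4$ also satisfies the $IC$-$\Pi$-property in $G$. Then $N\leq Z_{p\mathfrak{U}}(G)$. -/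

import Mathlib

namespace ICPi

variable {G : Type*} [Group G]

/-- `n` is a `π`-number: all prime divisors of `n` belong to `π`. -/
def IsPiNumber (π : Set ℕ) (n : ℕ) : Prop :=
  ∀ q : ℕ, q.Prime → q ∣ n → q ∈ π

/-- `π(A)`, the set of all primes dividing the order of `A`. -/
def primeSet (A : Type*) : Set ℕ :=
  {q | q.Prime ∧ q ∣ Nat.card A}

/-- `L / K` is a chief factor of `G`: `K < L` are normal subgroups of `G` and no normal subgroup
of `G` lies strictly between them. -/
structure IsChiefFactor (L K : Subgroup G) : Prop where
  normal_left : L.Normal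
  normal_right : K.Normal
  lt : K < L
  eq_or_eq : ∀ M : Subgroup G, M.Normal → K ≤ M → M ≤ L → M = K ∨ M = L

/-- The image `H K / K` of a subgroup `H` in `G / K`; when `K ≤ H` this is `H / K`. -/
def quot (H K : Subgroup G) [K.Normal] : Subgroup (G ⧸ K) :=
  H.map (QuotientGroup.mk' K)

/-- The `Π`-property of `H` in `G`: for every chief factor `L / K` of `G`, the index
`|G/K : N_{G/K}(HK/K ∩ L/K)|` is a `π(HK/K ∩ L/K)`-number. -/
def PiProperty (H : Subgroup G) : Prop :=
  ∀ (L K : Subgroup G) [K.Normal], IsChiefFactor L K →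
    IsPiNumber (primeSet ↥(quot H K ⊓ quot L K))
      (Subgroup.normalizer ((quot H K ⊓ quot L K : Subgroup (G ⧸ K)) : Set (G ⧸ K))).index

/-- The `IC`-`Π`-property of `H` in `G`: `H ∩ [H, G]` satisfies the `Π`-property in `G`. -/
def ICPiProperty (H : Subgroup G) : Prop :=
  PiProperty (H ⊓ ⁅H, (⊤ : Subgroup G)⁆)

/-- All chief factors of `G` below `H` whose order is divisible by `p` are cyclic. -/
def PChiefFactorsCyclicBelow (p : ℕ) (H : Subgroup G) : Prop :=
  ∀ (L K : Subgroup G) [K.Normal], IsChiefFactor L K → L ≤ H →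
    p ∣ Nat.card ↥(quot L K) → IsCyclic ↥(quot L K)

/-- The `p𝔘`-hypercenter `Z_{p𝔘}(G)`: the product of all normal subgroups `H` of `G` such that
all chief factors of `G` below `H` of order divisible by `p` are cyclic. (The product of a family
of normal subgroups is the subgroup they generate.) -/
def pSupersolubleHypercenter (p : ℕ) (G : Type*) [Group G] : Subgroup G :=
  sSup {H : Subgroup G | H.Normal ∧ PChiefFactorsCyclicBelow p H}

end ICPi

/-! Put e = 4 if p = 2 and P is non-abelian, and e = p otherwise. Only elements x of N with x^e = 1
enter. If x ∈ [⟨x⟩, G], then ⟨x⟩ ∩ [⟨x⟩, G] = ⟨x⟩, and the hypothesis makes |G : N_G(⟨x⟩K)| a power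
of p for each chief factor L/K with x ∈ L (`TorsionNormalizerIndex`). If R is normal and minimal
subject to R ≰ K, then for x ∈ R either this applies or [⟨x⟩, G] ≤ K, and then ⟨x⟩K is normal
anyway.

Suppose that L is a p-group (`IsChiefFactor.exists_zpowers_sup_eq`). By induction the factors below
K are cyclic, so G modulo their common centralizer A is abelian of exponent dividing p - 1. If the
p'-elements of A act trivially on L/K, then so does A, and an irreducible 𝔽_p-module of such a group
has dimension one. Otherwise let T be generated by these p'-elements. Then [L, T] centralizes K, and
coprime action shows that a minimal normal R ≤ [L, T] with R ≰ K satisfies x^e = 1 throughout. Some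
x ∈ R outside K is fixed modulo K by a Sylow p-subgroup, and ⟨x⟩K is normal.

In general, divide by a maximal G-normal p'-subgroup of N and let Q be the largest G-normal
p-subgroup of N. Then C_N(Q) ≤ Q (`centralizer_inf_le`): otherwise a suitable minimal R ≤ C_N(Q) has
all its e-torsion in Q, so its p'-elements centralize every p-subgroup of R that they normalize, and
Frobenius' theorem makes R a p-group. The p-elements of N act trivially on the cyclic factors below
Q, and therefore lie in Q. So each chief factor below N of order divisible by p is G-isomorphic to
one below Q. -/

namespace ICPi

open scoped commutatorElement

/-! ### Coprime action on p-groups -/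

section Coprime

variable {G : Type*} [Group G]

theorem conj_closure_le {S : Set G} {t : G} (h : ∀ x ∈ S, t * x * t⁻¹ ∈ Subgroup.closure S)
    {x : G} (hx : x ∈ Subgroup.closure S) : t * x * t⁻¹ ∈ Subgroup.closure S := by
  have : Subgroup.closure S ≤ (Subgroup.closure S).comap (MulAut.conj t).toMonoidHom :=
    (Subgroup.closure_le _).2 fun y hy => h y hy
  exact this hx

theorem exists_pow_eq_one_of_mem {p : ℕ} {U : Subgroup G} (hU : IsPGroup p U) {x : G}
    (hx : x ∈ U) : ∃ k : ℕ, x ^ p ^ k = 1 := by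
  obtain ⟨k, hk⟩ := isPGroup_iff_pow_pow_eq_one.1 hU ⟨x, hx⟩
  exact ⟨k, by simpa [Subtype.ext_iff] using hk⟩

/-- If a `p'`-element `t` centralizes the `p`-element `x⁻¹ x ^ t`, then it centralizes `x`. -/
theorem commute_of_commute_commutator {p : ℕ} {t x c : G} (ht : (orderOf t).Coprime p)
    (hc : t * x * t⁻¹ = x * c) {k : ℕ} (hck : c ^ p ^ k = 1) (h : Commute t c) :
    Commute t x := by
  have key : ∀ n : ℕ, t ^ n * x * (t ^ n)⁻¹ = x * c ^ n := by
    intro n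
    induction n with
    | zero => simp
    | succ n ih =>
      have h1 : t ^ (n + 1) * x * (t ^ (n + 1))⁻¹ = t * (t ^ n * x * (t ^ n)⁻¹) * t⁻¹ := by
        rw [pow_succ']; group
      have h2 : t * c ^ n * t⁻¹ = c ^ n := by rw [(h.pow_right n).eq]; group
      calc _ = t * (t ^ n * x * (t ^ n)⁻¹) * t⁻¹ := h1
        _ = (t * x * t⁻¹) * (t * c ^ n * t⁻¹) := by rw [ih]; group
        _ = _ := by rw [hc, h2, pow_succ']; group
  -- Here the left side of `key` is x, so the order of c divides that of t, while c is a p-element.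
  have h1 := key (orderOf t)
  rw [pow_orderOf_eq_one] at h1
  have h2 : c ^ orderOf t = 1 := by simpa using h1
  have h3 : c = 1 := by
    have hcop : (orderOf t).Coprime (p ^ k) := ht.pow_right k
    have := pow_gcd_eq_one.2 ⟨h2, hck⟩
    rwa [hcop.gcd_eq_one, pow_one] at this
  rw [h3, mul_one] at hc
  exact mul_inv_eq_iff_eq_mul.1 hc

theorem mul_pow_of_commute_commutator {x y c : G} (h : y * x = x * y * c) (hx : Commute x c)
    (hy : Commute y c) (n : ℕ) : (x * y) ^ n = x ^ n * y ^ n * c ^ n.choose 2 := by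
  have hyn : ∀ n : ℕ, y ^ n * x = x * y ^ n * c ^ n := by
    intro n
    induction n with
    | zero => simp
    | succ n ih =>
      calc y ^ (n + 1) * x = y * (y ^ n * x) := by rw [pow_succ']; group
        _ = (y * x) * y ^ n * c ^ n := by rw [ih]; group
        _ = x * y * (c * y ^ n) * c ^ n := by rw [h]; group
        _ = x * y * (y ^ n * c) * c ^ n := by rw [((hy.pow_left n).symm).eq]
        _ = _ := by rw [pow_succ' y, pow_succ' c]; group
  induction n with
  | zero => simp
  | succ n ih =>
    have hcx : ∀ m : ℕ, Commute x (c ^ m) := fun m => hx.pow_right m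
    have hcy : ∀ m : ℕ, Commute y (c ^ m) := fun m => hy.pow_right m
    rw [pow_succ, ih, Nat.choose_succ_succ' n 1, Nat.choose_one_right]
    calc x ^ n * y ^ n * c ^ n.choose 2 * (x * y)
        = x ^ n * y ^ n * (c ^ n.choose 2 * (x * y)) := by group
      _ = x ^ n * y ^ n * (x * y * c ^ n.choose 2) := by
          rw [((hcx _).mul_left (hcy _)).symm.eq]
      _ = x ^ n * (y ^ n * x) * y * c ^ n.choose 2 := by group
      _ = x ^ n * x * y ^ n * (c ^ n * y) * c ^ n.choose 2 := by rw [hyn]; group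
      _ = x ^ n * x * y ^ n * (y * c ^ n) * c ^ n.choose 2 := by rw [(hcy n).symm.eq]
      _ = _ := by rw [pow_succ x, pow_succ y, pow_add]; group

/-- The exponent `e` is `p`, or it is `4` and `p = 2`; in the exceptional case `p = e = 2`
the subgroup `U` is required to be commutative. -/
def TorsionExponent (p e : ℕ) (U : Subgroup G) : Prop :=
  (e = p ∧ (p = 2 → ∀ x ∈ U, ∀ y ∈ U, x * y = y * x)) ∨ (p = 2 ∧ e = 4)

theorem TorsionExponent.mono {p e : ℕ} {U V : Subgroup G} (h : TorsionExponent p e V)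
    (hUV : U ≤ V) : TorsionExponent p e U :=
  h.imp (fun h => ⟨h.1, fun h2 x hx y hy => h.2 h2 x (hUV hx) y (hUV hy)⟩) id

theorem TorsionExponent.dvd {p e : ℕ} {U : Subgroup G} (h : TorsionExponent p e U) : p ∣ e := by
  rcases h with ⟨rfl, -⟩ | ⟨rfl, rfl⟩
  · exact dvd_rfl
  · norm_num

theorem TorsionExponent.dvd_sq {p e : ℕ} {U : Subgroup G} (h : TorsionExponent p e U) :
    e ∣ p ^ 2 := by
  rcases h with ⟨rfl, -⟩ | ⟨rfl, rfl⟩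
  · exact dvd_pow_self _ two_ne_zero
  · norm_num

/-- In a group of class two with central `p`-th powers the `e`-th power map is multiplicative. -/
theorem mul_pow_torsionExponent {p e : ℕ} [hp : Fact p.Prime] {U : Subgroup G}
    (he : TorsionExponent p e U) {x y : G} (hx : x ∈ U) (hy : y ∈ U)
    (hcx : Commute x (y⁻¹ * x⁻¹ * y * x)) (hcy : Commute y (y⁻¹ * x⁻¹ * y * x))
    (hpow : Commute (x ^ p) y) : (x * y) ^ e = x ^ e * y ^ e := by
  set c := y⁻¹ * x⁻¹ * y * x with hc
  have hyx : y * x = x * y * c := by rw [hc]; group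
  rw [mul_pow_of_commute_commutator hyx hcx hcy]
  suffices h : c ^ e.choose 2 = 1 by rw [h, mul_one]
  -- Conjugation by y fixes x^p, but also multiplies it by c^p.
  have hcp : c ^ p = 1 := by
    have h1 : y * x * y⁻¹ = x * c := by
      rw [mul_inv_eq_iff_eq_mul, hyx, mul_assoc x y c, mul_assoc x c y, hcy.eq]
    have h2 : y * x ^ p * y⁻¹ = x ^ p * c ^ p := by
      rw [← conj_pow, h1, hcx.mul_pow]
    rw [← hpow.eq] at h2
    simpa using h2
  rcases he with ⟨rfl, hab⟩ | ⟨rfl, rfl⟩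
  · by_cases h2 : e = 2
    · have : c = 1 := by
        have := hab h2 x hx y hy
        rw [hc, mul_assoc, ← this]; group
      rw [this, one_pow]
    · have hdvd : e ∣ e.choose 2 :=
        hp.out.dvd_choose_self two_ne_zero (lt_of_le_of_ne hp.out.two_le (Ne.symm h2))
      obtain ⟨m, hm⟩ := hdvd
      rw [hm, pow_mul, hcp, one_pow]
  · rw [show Nat.choose 4 2 = 2 * 3 by rfl, pow_mul, hcp, one_pow]

/-- A proper subgroup `K` of a finite `p`-subgroup `U` is contained in a proper subgroup that
contains all commutators and `p`-th powers of elements of `U`. -/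
theorem exists_lt_commutator_pow_mem {p : ℕ} [hp : Fact p.Prime] [Finite G] {U K : Subgroup G}
    (hU : IsPGroup p U) (hK : K < U) : ∃ M < U, K ≤ M ∧ (∀ x ∈ U, x ^ p ∈ M) ∧
      ∀ x ∈ U, ∀ y ∈ U, x * y * x⁻¹ * y⁻¹ ∈ M := by
  obtain ⟨n, hn⟩ := IsPGroup.iff_card.1 hU
  obtain ⟨k, hk⟩ := IsPGroup.iff_card.1 (hU.to_subgroup (K.subgroupOf U))
  have hkn : k < n := by
    have h1 : Nat.card (K.subgroupOf U) < Nat.card U := by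
      rw [Nat.card_congr (Subgroup.subgroupOfEquivOfLe hK.le).toEquiv]
      exact Set.ncard_lt_ncard hK
    rw [hk, hn] at h1
    exact (Nat.pow_lt_pow_iff_right hp.out.one_lt).1 h1
  obtain ⟨m, rfl⟩ := Nat.exists_eq_succ_of_ne_zero (Nat.ne_zero_of_lt hkn)
  obtain ⟨M, hM, hKM⟩ := Sylow.exists_subgroup_card_pow_prime_le (G := U) p (n := k) (m := m)
    (by rw [hn]; exact pow_dvd_pow _ (Nat.le_succ m)) _ hk (Nat.le_of_lt_succ hkn)
  have hidx : M.index = p := by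
    have := M.card_mul_index
    rw [hM, hn, pow_succ] at this
    exact Nat.eq_of_mul_eq_mul_left (pow_pos hp.out.pos m) this
  have hmf : M.index = (Nat.card U).minFac := by
    rw [hidx, hn, hp.out.pow_minFac (Nat.succ_ne_zero m)]
  have hMn : M.Normal := Subgroup.normal_of_index_eq_minFac_card hmf
  have hcard : Nat.card (U ⧸ M) = p := hidx
  have hcyc : IsCyclic (U ⧸ M) := isCyclic_of_prime_card hcard
  refine ⟨M.map U.subtype, lt_of_le_of_ne (Subgroup.map_subtype_le M) ?_,
    fun x hx => ⟨⟨x, hK.le hx⟩, hKM (Subgroup.mem_subgroupOf.2 hx), rfl⟩, ?_, ?_⟩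
  · intro h
    have h1 : Nat.card (M.map U.subtype) = Nat.card M := Subgroup.card_subtype U M
    rw [h, hn, hM] at h1
    have := Nat.pow_right_injective hp.out.two_le h1
    omega
  · intro x hx
    refine ⟨⟨x, hx⟩ ^ p, ?_, rfl⟩
    have := pow_card_eq_one' (x := (QuotientGroup.mk (⟨x, hx⟩ : U) : U ⧸ M))
    rw [hcard, ← QuotientGroup.mk_pow] at this
    exact (QuotientGroup.eq_one_iff _).1 this
  · intro x hx y hy
    refine ⟨⟨x, hx⟩ * ⟨y, hy⟩ * ⟨x, hx⟩⁻¹ * ⟨y, hy⟩⁻¹, ?_, rfl⟩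
    refine (QuotientGroup.eq_one_iff _).1 ?_
    let := hcyc.commGroup
    simp only [QuotientGroup.mk_mul, QuotientGroup.mk_inv]
    rw [mul_comm (QuotientGroup.mk (⟨x, hx⟩ : U) : U ⧸ M)]
    group

/-- A `p'`-element that normalizes a `p`-subgroup `U` and centralizes its elements of order
dividing `p` (or `4` if `p = 2` and `U` is not commutative) centralizes `U`. -/
theorem commute_of_commute_torsion {p e : ℕ} [hp : Fact p.Prime] [Finite G] {t : G}
    (ht : (orderOf t).Coprime p) (U : Subgroup G) (hU : IsPGroup p U)
    (htU : ∀ x ∈ U, t * x * t⁻¹ ∈ U) (he : TorsionExponent p e U)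
    (h : ∀ x ∈ U, x ^ e = 1 → Commute t x) : ∀ x ∈ U, Commute t x := by
  induction hn : Nat.card U using Nat.strong_induction_on generalizing U with
  | _ n IH =>
  subst hn
  have hlt : ∀ V < U, (∀ x ∈ V, t * x * t⁻¹ ∈ V) → ∀ x ∈ V, Commute t x := by
    intro V hV htV
    refine IH (Nat.card V) ?_ V (hU.to_le hV.le) htV (he.mono hV.le)
      (fun x hx => h x (hV.le hx)) rfl
    exact Set.ncard_lt_ncard hV
  have hdU : ∀ x ∈ U, x⁻¹ * (t * x * t⁻¹) ∈ U := fun x hx => U.mul_mem (U.inv_mem hx) (htU x hx)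
  have hone : ∀ x ∈ U, Commute t (x⁻¹ * (t * x * t⁻¹)) → Commute t x := by
    intro x hx hd
    obtain ⟨k, hk⟩ := exists_pow_eq_one_of_mem hU (hdU x hx)
    exact commute_of_commute_commutator ht (by group) hk hd
  -- This is [U, t]. If it is proper, induction and `hone` finish; afterwards U = [U, t].
  set D := Subgroup.closure ((fun x => x⁻¹ * (t * x * t⁻¹)) '' (U : Set G)) with hD
  have hDU : D ≤ U := (Subgroup.closure_le _).2 (by rintro _ ⟨x, hx, rfl⟩; exact hdU x hx)
  have htD : ∀ x ∈ D, t * x * t⁻¹ ∈ D := fun x hx => conj_closure_le (by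
    rintro _ ⟨x, hx, rfl⟩
    exact Subgroup.subset_closure ⟨t * x * t⁻¹, htU x hx, by group⟩) hx
  have hmemD : ∀ x ∈ U, x⁻¹ * (t * x * t⁻¹) ∈ D := fun x hx => Subgroup.subset_closure ⟨x, hx, rfl⟩
  rcases hDU.lt_or_eq with hDlt | hDeq
  · exact fun x hx => hone x hx (hlt D hDlt htD _ (hmemD x hx))
  by_cases hbot : U = ⊥
  · intro x hx
    rw [hbot, Subgroup.mem_bot] at hx
    rw [hx]; exact Commute.one_right t
  obtain ⟨M, hMU, -, hMp, hMc⟩ := exists_lt_commutator_pow_mem hU (bot_lt_iff_ne_bot.2 hbot)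
  set S : Set G := {z | ∃ x ∈ U, z = x ^ p} ∪ {z | ∃ x ∈ U, ∃ y ∈ U, z = x * y * x⁻¹ * y⁻¹} with hS
  set F := Subgroup.closure S with hF
  have hFM : F ≤ M := by
    refine (Subgroup.closure_le _).2 ?_
    rintro _ (⟨x, hx, rfl⟩ | ⟨x, hx, y, hy, rfl⟩)
    exacts [hMp x hx, hMc x hx y hy]
  have hFU : F < U := lt_of_le_of_lt hFM hMU
  have hconj : ∀ s : G, (∀ x ∈ U, s * x * s⁻¹ ∈ U) → ∀ x ∈ F, s * x * s⁻¹ ∈ F := by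
    intro s hs x hx
    refine conj_closure_le ?_ hx
    rintro _ (⟨x, hx, rfl⟩ | ⟨x, hx, y, hy, rfl⟩)
    · exact Subgroup.subset_closure (Or.inl ⟨s * x * s⁻¹, hs x hx, by rw [conj_pow]⟩)
    · exact Subgroup.subset_closure (Or.inr ⟨s * x * s⁻¹, hs x hx, s * y * s⁻¹, hs y hy, by group⟩)
  have htF := hlt F hFU (hconj t htU)
  -- Three-subgroup argument: t centralizes F, which is normalized by U, so [U, t] = U centralizes
  -- F.
  have hFc : ∀ c ∈ F, ∀ x ∈ U, Commute c x := by
    intro c hc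
    have : D ≤ Subgroup.centralizer {c} := by
      refine (Subgroup.closure_le _).2 ?_
      rintro _ ⟨x, hx, rfl⟩
      refine Subgroup.mem_centralizer_singleton_iff.2 ?_
      have h1 : Commute t (x * c * x⁻¹) :=
        htF _ (hconj x (fun y hy => U.mul_mem (U.mul_mem hx hy) (U.inv_mem hx)) c hc)
      have h2 : Commute t c := htF c hc
      have h3 : t * (x * c * x⁻¹) * t⁻¹ = x * c * x⁻¹ := by rw [h1.eq]; group
      have h4 : t⁻¹ * c * t = c := by rw [mul_assoc, ← h2.eq]; group
      have h5 : x⁻¹ * (t * x * t⁻¹) * c * (x⁻¹ * (t * x * t⁻¹))⁻¹ = c := by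
        calc _ = x⁻¹ * (t * (x * (t⁻¹ * c * t) * x⁻¹) * t⁻¹) * x := by group
          _ = c := by rw [h4, h3]; group
      exact mul_inv_eq_iff_eq_mul.1 h5
    intro x hx
    exact (Subgroup.mem_centralizer_singleton_iff.1 (this (hDeq ▸ hx))).symm
  intro x hx
  -- It remains to see that x⁻¹ · txt⁻¹ is killed by e. The e-th power map is multiplicative here,
  -- and t fixes x^e ∈ F.
  refine hone x hx (h _ (hdU x hx) ?_)
  have hy : t * x * t⁻¹ ∈ U := htU x hx
  have hcomm : (t * x * t⁻¹)⁻¹ * (x⁻¹)⁻¹ * (t * x * t⁻¹) * x⁻¹ ∈ F :=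
    Subgroup.subset_closure (Or.inr ⟨_, U.inv_mem hy, x, hx, by group⟩)
  have hxp : x⁻¹ ^ p ∈ F := Subgroup.subset_closure (Or.inl ⟨x⁻¹, U.inv_mem hx, rfl⟩)
  rw [mul_pow_torsionExponent he (U.inv_mem hx) hy (hFc _ hcomm _ (U.inv_mem hx)).symm
    (hFc _ hcomm _ hy).symm (hFc _ hxp _ hy)]
  obtain ⟨m, hm⟩ := he.dvd
  have hxe : x ^ e ∈ F := by
    rw [hm, pow_mul]
    exact F.pow_mem (Subgroup.subset_closure (Or.inl ⟨x, hx, rfl⟩)) m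
  rw [conj_pow, (htF _ hxe).eq]
  group

end Coprime

/-! ### Frobenius' normal p-complement theorem -/

section NormalComplement

/-- No prime divides the index: P excludes p, and for q ≠ p a Sylow q-subgroup consists of
p'-elements. -/
theorem eq_top_of_sylow_le {G : Type*} [Group G] [Finite G] {p : ℕ} [Fact p.Prime]
    (H : Subgroup G) (P : Sylow p G) (hP : (P : Subgroup G) ≤ H)
    (h : ∀ t : G, (orderOf t).Coprime p → t ∈ H) : H = ⊤ := by
  by_contra hne
  obtain ⟨q, hq, hdvd⟩ := Nat.exists_prime_and_dvd (mt Subgroup.index_eq_one.1 hne)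
  have : Fact q.Prime := ⟨hq⟩
  by_cases hqp : q = p
  · subst hqp
    exact P.not_dvd_index (hdvd.trans (Subgroup.index_dvd_of_le hP))
  · obtain ⟨Q⟩ : Nonempty (Sylow q G) := inferInstance
    refine Q.not_dvd_index (hdvd.trans (Subgroup.index_dvd_of_le fun x hx => h x ?_))
    obtain ⟨k, hk⟩ := exists_pow_eq_one_of_mem Q.isPGroup' hx
    exact Nat.Coprime.coprime_dvd_left (orderOf_dvd_of_pow_eq_one hk)
      (((Nat.coprime_primes hq (Fact.out : p.Prime)).2 hqp).pow_left k)

/-- Every `p'`-element that normalizes a `p`-subgroup centralizes it. -/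
def LocallyNilpotentAt (p : ℕ) (G : Type*) [Group G] : Prop :=
  ∀ U : Subgroup G, IsPGroup p U → ∀ t : G, (orderOf t).Coprime p →
    (∀ x ∈ U, t * x * t⁻¹ ∈ U) → ∀ x ∈ U, Commute t x

theorem LocallyNilpotentAt.subgroup {G : Type*} [Group G] {p : ℕ} (hG : LocallyNilpotentAt p G)
    (H : Subgroup G) :
    LocallyNilpotentAt p H := by
  intro U hU t ht htU x hx
  have h := hG (U.map H.subtype) (hU.map _) t (by rwa [Subgroup.orderOf_coe])
    (by rintro _ ⟨y, hy, rfl⟩; exact ⟨_, htU y hy, rfl⟩) x ⟨x, hx, rfl⟩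
  exact Subtype.ext h.eq

variable {G : Type*} [Group G] [Finite G] {p : ℕ} [Fact p.Prime]

/-- The centralizer of D is normal in the normalizer and contains its p'-elements, so together with
T it is everything. -/
theorem LocallyNilpotentAt.exists_mul_eq (hG : LocallyNilpotentAt p G) {D : Subgroup G}
    (hD : IsPGroup p D) (T : Sylow p (Subgroup.normalizer (D : Set G)))
    (n : Subgroup.normalizer (D : Set G)) :
    ∃ t ∈ T, ∃ c : Subgroup.normalizer (D : Set G), (c : G) ∈ Subgroup.centralizer (D : Set G) ∧
      t * c = n := by
  let N := Subgroup.normalizer (D : Set G)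
  have hconj : ∀ n ∈ N, ∀ x ∈ D, n * x * n⁻¹ ∈ D := fun n hn x hx =>
    (Subgroup.mem_normalizer_iff.1 hn x).1 hx
  let C := (Subgroup.centralizer (D : Set G)).subgroupOf N
  have hCn : C.Normal := by
    refine ⟨fun c hc g => Subgroup.mem_subgroupOf.2 (Subgroup.mem_centralizer_iff.2 ?_)⟩
    intro x hx
    have h1 := Subgroup.mem_centralizer_iff.1 (Subgroup.mem_subgroupOf.1 hc) _
      (hconj _ (N.inv_mem g.2) x hx)
    push_cast
    calc x * (g * c * (g : G)⁻¹) = g * (((g : G)⁻¹ * x * (g : G)⁻¹⁻¹) * c) * (g : G)⁻¹ := by group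
      _ = _ := by rw [h1]; group
  have htop : (T : Subgroup N) ⊔ C = ⊤ := by
    refine eq_top_of_sylow_le _ T le_sup_left fun t ht => Subgroup.mem_sup_right ?_
    refine Subgroup.mem_subgroupOf.2 (Subgroup.mem_centralizer_iff.2 fun x hx => ?_)
    exact (hG D hD t (by rwa [Subgroup.orderOf_coe]) (hconj t t.2) x hx).symm
  have hn : n ∈ ((T : Subgroup N) ⊔ C : Subgroup N) := htop ▸ Subgroup.mem_top n
  rw [← SetLike.mem_coe, Subgroup.mul_normal] at hn
  obtain ⟨t, ht, c, hc, h⟩ := hn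
  exact ⟨t, ht, c, hc, h⟩

theorem exists_mem_normalizer_notMem {P D : Subgroup G} (hP : IsPGroup p P) (hD : D < P) :
    ∃ g ∈ P, g ∉ D ∧ g ∈ Subgroup.normalizer (D : Set G) := by
  have := hP.isNilpotent
  have hlt : D.subgroupOf P < ⊤ := by
    rw [lt_top_iff_ne_top, Ne, Subgroup.subgroupOf_eq_top]
    exact not_le_of_gt hD
  obtain ⟨g, hg, hgD⟩ := SetLike.exists_of_lt
    (Group.normalizerCondition_of_isNilpotent (G := P) _ hlt)
  refine ⟨g, g.2, fun h => hgD (Subgroup.mem_subgroupOf.2 h), ?_⟩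
  refine Subgroup.mem_normalizer_fintype fun x hx => ?_
  have := (Subgroup.mem_normalizer_iff.1 hg ⟨x, hD.le hx⟩).1 (Subgroup.mem_subgroupOf.2 hx)
  exact Subgroup.mem_subgroupOf.1 this

/-- Alperin's argument, by induction towards larger intersections. Sylow subgroups of N_G(D), D = P
∩ Q, containing P ∩ N_G(D) and Q ∩ N_G(D) are conjugate by an element c centralizing D. If R is a
Sylow subgroup of G over the first, then P ∩ R and cRc⁻¹ ∩ Q are larger than D because normalizers
grow in p-groups. -/
theorem LocallyNilpotentAt.exists_smul_eq (hG : LocallyNilpotentAt p G) (P Q : Sylow p G) :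
    ∃ c ∈ Subgroup.centralizer (((P : Subgroup G) ⊓ Q : Subgroup G) : Set G), c • P = Q := by
  induction hn : Nat.card G - Nat.card ((P : Subgroup G) ⊓ Q : Subgroup G) using
    Nat.strong_induction_on generalizing P Q with
  | _ n IH =>
  by_cases hPQ : P = Q
  · exact ⟨1, Subgroup.one_mem _, by rw [one_smul, hPQ]⟩
  set D : Subgroup G := (P : Subgroup G) ⊓ Q with hD
  have hDP : D < P := lt_of_le_of_ne inf_le_left fun h =>
    hPQ (Sylow.ext (P.is_maximal' Q.isPGroup' (inf_eq_left.1 h)).symm)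
  have hDQ : D < Q := lt_of_le_of_ne inf_le_right fun h =>
    hPQ (Sylow.ext (Q.is_maximal' P.isPGroup' (inf_eq_right.1 h)))
  have hDp : IsPGroup p D := P.isPGroup'.to_le hDP.le
  have hlt : ∀ (A B : Sylow p G), D < (A : Subgroup G) ⊓ B →
      Nat.card G - Nat.card ((A : Subgroup G) ⊓ B : Subgroup G) < n := by
    intro A B hAB
    have h1 : Nat.card D < Nat.card ((A : Subgroup G) ⊓ B : Subgroup G) := Set.ncard_lt_ncard hAB
    have h2 := Subgroup.card_le_card_group ((A : Subgroup G) ⊓ B : Subgroup G)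
    omega
  set N := Subgroup.normalizer (D : Set G) with hN
  have hDN : D ≤ N := Subgroup.le_normalizer
  obtain ⟨S, hS⟩ := (P.isPGroup'.comap_subtype (K := N)).exists_le_sylow
  obtain ⟨T, hT⟩ := (Q.isPGroup'.comap_subtype (K := N)).exists_le_sylow
  obtain ⟨m, hm⟩ := MulAction.exists_smul_eq N S T
  obtain ⟨t, ht, c, hc, htc⟩ := hG.exists_mul_eq hDp T m
  have hcS : c • S = T := by
    have : t⁻¹ • T = T := Sylow.smul_eq_iff_mem_normalizer.2
      (Subgroup.le_normalizer (T.inv_mem ht))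
    rw [← this, ← hm, ← htc, smul_smul, inv_mul_cancel_left]
  obtain ⟨R, hR⟩ := (S.isPGroup'.map N.subtype).exists_le_sylow
  have hPR : D < (P : Subgroup G) ⊓ R := by
    obtain ⟨g, hgP, hgD, hgN⟩ := exists_mem_normalizer_notMem P.isPGroup' hDP
    refine lt_of_le_of_ne (le_inf hDP.le fun x hx => hR ⟨⟨x, hDN hx⟩, hS ?_, rfl⟩) fun h => hgD ?_
    · exact Subgroup.mem_comap.2 (hDP.le hx)
    · rw [h]
      exact ⟨hgP, hR ⟨⟨g, hgN⟩, hS (Subgroup.mem_comap.2 hgP), rfl⟩⟩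
  have hTR : ∀ x : N, x ∈ T → (x : G) ∈ ((c : G) • R : Sylow p G) := by
    intro x hx
    rw [← hcS] at hx
    obtain ⟨y, hy, rfl⟩ := hx
    exact ⟨y, hR ⟨y, hy, rfl⟩, rfl⟩
  have hQR : D < (((c : G) • R : Sylow p G) : Subgroup G) ⊓ Q := by
    obtain ⟨g, hgQ, hgD, hgN⟩ := exists_mem_normalizer_notMem Q.isPGroup' hDQ
    refine lt_of_le_of_ne (le_inf (fun x hx => hTR ⟨x, hDN hx⟩ (hT ?_)) hDQ.le) fun h => hgD ?_
    · exact Subgroup.mem_comap.2 (hDQ.le hx)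
    · rw [h]
      exact ⟨hTR ⟨g, hgN⟩ (hT (Subgroup.mem_comap.2 hgQ)), hgQ⟩
  obtain ⟨c₁, hc₁, h₁⟩ := IH _ (hlt P R hPR) P R rfl
  obtain ⟨c₂, hc₂, h₂⟩ := IH _ (hlt _ Q hQR) _ Q rfl
  refine ⟨c₂ * c * c₁, ?_, by rw [mul_smul, mul_smul, h₁, h₂]⟩
  exact Subgroup.mul_mem _ (Subgroup.mul_mem _
    (Subgroup.centralizer_le (SetLike.coe_subset_coe.2 hQR.le) hc₂) hc)
    (Subgroup.centralizer_le (SetLike.coe_subset_coe.2 hPR.le) hc₁)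

/-- P controls its own fusion: u can be corrected by an element centralizing P ∩ uPu⁻¹ so as to
normalize P, and N_G(P) = P C_G(P). -/
theorem LocallyNilpotentAt.exists_conj_eq (hG : LocallyNilpotentAt p G) (P : Sylow p G)
    {x u : G} (hx : x ∈ P) (hu : u * x * u⁻¹ ∈ P) : ∃ v ∈ P, u * x * u⁻¹ = v * x * v⁻¹ := by
  obtain ⟨c, hc, hcP⟩ := hG.exists_smul_eq (u • P) P
  rw [smul_smul] at hcP
  have hcx := Subgroup.mem_centralizer_iff.1 hc (u * x * u⁻¹) ⟨⟨x, hx, rfl⟩, hu⟩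
  have hN : c * u ∈ Subgroup.normalizer ((P : Subgroup G) : Set G) :=
    Sylow.smul_eq_iff_mem_normalizer.1 hcP
  obtain ⟨t, ht, d, hd, htd⟩ := hG.exists_mul_eq P.isPGroup' (P.subtype Subgroup.le_normalizer)
    ⟨c * u, hN⟩
  have htP : (t : G) ∈ P := ht
  refine ⟨t, htP, ?_⟩
  have htd' : (t : G) * d = c * u := congrArg Subtype.val htd
  have h1 : (d : G) * x * (d : G)⁻¹ = x := by
    rw [← Subgroup.mem_centralizer_iff.1 hd x hx]; group
  calc u * x * u⁻¹ = c * (u * x * u⁻¹) * c⁻¹ := by rw [← hcx]; group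
    _ = (c * u) * x * (c * u)⁻¹ := by group
    _ = ((t : G) * d) * x * ((t : G) * d)⁻¹ := by rw [htd']
    _ = t * (d * x * (d : G)⁻¹) * (t : G)⁻¹ := by rw [mul_inv_rev]; simp only [mul_assoc]
    _ = _ := by rw [h1]

/-- By control of fusion the generators of the focal subgroup are commutators of elements of P. -/
theorem LocallyNilpotentAt.focalSubgroup_ne (hG : LocallyNilpotentAt p G) (P : Sylow p G)
    (hP : (P : Subgroup G) ≠ ⊥) : (P : Subgroup G).focalSubgroup ≠ P := by
  obtain ⟨M, hM, -, -, hMc⟩ := exists_lt_commutator_pow_mem P.isPGroup' (bot_lt_iff_ne_bot.2 hP)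
  refine (lt_of_le_of_lt ?_ hM).ne
  rw [Subgroup.focalSubgroup_def, Subgroup.closure_le]
  rintro _ ⟨hg, x, hx, u, rfl⟩
  rw [commutatorElement_def] at hg ⊢
  have hu : u * x⁻¹ * u⁻¹ ∈ P := by
    have := (P : Subgroup G).mul_mem ((P : Subgroup G).inv_mem hx) hg
    rwa [show x⁻¹ * (x * u * x⁻¹ * u⁻¹) = u * x⁻¹ * u⁻¹ by group] at this
  obtain ⟨v, hv, h⟩ := hG.exists_conj_eq P (P.inv_mem hx) hu
  have := hMc x hx v hv
  rw [SetLike.mem_coe, show x * u * x⁻¹ * u⁻¹ = x * (u * x⁻¹ * u⁻¹) by group, h]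
  convert this using 1
  group

/-- **Frobenius' normal `p`-complement theorem**: if all `p'`-elements normalizing a `p`-subgroup
centralize it, then the `p'`-elements form a subgroup. -/
theorem LocallyNilpotentAt.exists_complement {G : Type*} [Group G] [Finite G]
    (hG : LocallyNilpotentAt p G) :
    ∃ H : Subgroup G, ∀ x, x ∈ H ↔ (orderOf x).Coprime p := by
  induction hn : Nat.card G using Nat.strong_induction_on generalizing G with
  | _ n IH =>
  subst hn
  obtain ⟨P⟩ : Nonempty (Sylow p G) := inferInstance
  by_cases hP : (P : Subgroup G) = ⊥
  · refine ⟨⊤, fun x => iff_of_true (Subgroup.mem_top x) ?_⟩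
    have h1 : ¬ p ∣ Nat.card G := by
      have := P.not_dvd_index
      rwa [hP, Subgroup.index_bot] at this
    exact Nat.Coprime.symm (((Fact.out : p.Prime).coprime_iff_not_dvd).2
      fun h => h1 (h.trans (orderOf_dvd_natCard x)))
  -- The transfer to the p-group P modulo its focal subgroup has a proper kernel containing all
  -- p'-elements; induction applies to that kernel.
  set V := (P : Subgroup G).transferFocal with hV
  have hlt : V.ker < ⊤ := by
    refine lt_top_iff_ne_top.2 fun h => hG.focalSubgroup_ne P hP ?_
    rw [← Subgroup.ker_transferFocal_inf_eq_focalSubgroup, ← hV, h, top_inf_eq]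
  obtain ⟨H, hH⟩ := IH _ (by
    rw [← Subgroup.card_top (G := G)]; exact Set.ncard_lt_ncard hlt) (hG.subgroup V.ker) rfl
  refine ⟨H.map V.ker.subtype, fun x => ⟨?_, fun hx => ?_⟩⟩
  · rintro ⟨y, hy, rfl⟩
    have := (hH y).1 hy
    rwa [← Subgroup.orderOf_coe] at this
  · have hxV : x ∈ V.ker := by
      obtain ⟨k, hk⟩ := isPGroup_iff_pow_pow_eq_one.1
        (P.isPGroup'.to_quotient (P : Subgroup G).focalSubgroupOf) (V x)
      have h1 : V x ^ orderOf x = 1 := by rw [← map_pow, pow_orderOf_eq_one, map_one]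
      have h2 := pow_gcd_eq_one.2 ⟨h1, hk⟩
      rw [(hx.pow_right k).gcd_eq_one, pow_one] at h2
      exact h2
    refine ⟨⟨x, hxV⟩, (hH _).2 ?_, rfl⟩
    rwa [← Subgroup.orderOf_coe]

end NormalComplement

/-! ### Subgroups whose normalizer has p-power index -/

section Factorization

variable {G : Type*} [Group G] [Finite G] {p : ℕ} [Fact p.Prime]

/-- If all prime divisors of the index of `N` equal `p`, then `G = S N` for every Sylow
`p`-subgroup `S`. -/
theorem exists_sylow_mul_eq (N : Subgroup G) (hN : ∀ q : ℕ, q.Prime → q ∣ N.index → q = p)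
    (S : Sylow p G) (g : G) : ∃ s ∈ S, ∃ n ∈ N, s * n = g := by
  have hcop : Nat.Coprime N.index (S : Subgroup G).index := by
    refine Nat.Coprime.symm (Nat.coprime_of_dvd fun q hq h1 h2 => ?_)
    have := hN q hq h2
    subst this
    exact S.not_dvd_index h1
  -- This divisibility forces the S-orbit of the trivial coset to be all of G/N.
  have h1 : N.index ∣ N.relIndex S := by
    have h2 : N.index ∣ (N ⊓ S : Subgroup G).index := Subgroup.index_dvd_of_le inf_le_left
    rw [← Subgroup.relIndex_mul_index (inf_le_right : N ⊓ S ≤ (S : Subgroup G)),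
      Subgroup.inf_relIndex_right] at h2
    exact hcop.dvd_of_dvd_mul_right h2
  have h3 : (MulAction.stabilizer S ((1 : G) : G ⧸ N)) = N.subgroupOf S := by
    ext s
    rw [MulAction.mem_stabilizer_iff, Subgroup.mem_subgroupOf]
    change (((s : G) * 1 : G) : G ⧸ N) = ((1 : G) : G ⧸ N) ↔ _
    rw [mul_one, eq_comm, QuotientGroup.eq, inv_one, one_mul]
  have h4 := MulAction.index_stabilizer S ((1 : G) : G ⧸ N)
  rw [h3] at h4
  have h5 : MulAction.orbit S ((1 : G) : G ⧸ N) = Set.univ := by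
    refine Set.eq_of_subset_of_ncard_le (Set.subset_univ _) ?_
    rw [← h4, Set.ncard_univ]
    exact Nat.le_of_dvd (Nat.pos_of_ne_zero Subgroup.index_ne_zero_of_finite) h1
  obtain ⟨s, hs⟩ : (g : G ⧸ N) ∈ MulAction.orbit S ((1 : G) : G ⧸ N) := h5 ▸ Set.mem_univ _
  refine ⟨s, s.2, (s : G)⁻¹ * g, ?_, by group⟩
  have hs' : (((s : G) * 1 : G) : G ⧸ N) = g := hs
  rw [mul_one] at hs'
  exact QuotientGroup.eq.1 hs'

/-- Since G = S N_G(M), every conjugate of M is an S-conjugate of M ≤ S. -/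
theorem conj_mem_sylow (M : Subgroup G)
    (hM : ∀ q : ℕ, q.Prime → q ∣ (Subgroup.normalizer (M : Set G)).index → q = p)
    (S : Sylow p G) (hMS : M ≤ S) {x : G} (hx : x ∈ M) (g : G) : g * x * g⁻¹ ∈ S := by
  obtain ⟨s, hs, n, hn, rfl⟩ := exists_sylow_mul_eq _ hM S g
  have h1 := hMS ((Subgroup.mem_normalizer_iff.1 hn x).1 hx)
  have := (S : Subgroup G).mul_mem ((S : Subgroup G).mul_mem hs h1) ((S : Subgroup G).inv_mem hs)
  rw [show s * n * x * (s * n)⁻¹ = s * (n * x * n⁻¹) * s⁻¹ by group]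
  exact this

theorem normal_of_sylow_le_normalizer (M : Subgroup G)
    (hM : ∀ q : ℕ, q.Prime → q ∣ (Subgroup.normalizer (M : Set G)).index → q = p)
    (S : Sylow p G) (hS : (S : Subgroup G) ≤ Subgroup.normalizer (M : Set G)) : M.Normal := by
  rw [← Subgroup.normalizer_eq_top_iff, ← Subgroup.index_eq_one]
  by_contra hne
  obtain ⟨q, hq, hdvd⟩ := Nat.exists_prime_and_dvd hne
  have := hM q hq hdvd
  subst this
  exact S.not_dvd_index (hdvd.trans (Subgroup.index_dvd_of_le hS))

end Factorization

/-! ### Commutators with G and elements central modulo K -/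

section Commutator

variable {G : Type*} [Group G]

theorem commutator_top_normal (H : Subgroup G) : (⁅H, (⊤ : Subgroup G)⁆).Normal := by
  refine ⟨fun n hn g => ?_⟩
  rw [Subgroup.commutator_def] at hn ⊢
  refine conj_closure_le ?_ hn
  rintro _ ⟨x, hx, h, -, rfl⟩
  have h1 : ⁅x, g⁆ ∈ Subgroup.closure {z | ∃ a ∈ H, ∃ b ∈ (⊤ : Subgroup G), ⁅a, b⁆ = z} :=
    Subgroup.subset_closure ⟨x, hx, g, Subgroup.mem_top _, rfl⟩
  have h2 : ⁅x, g * h⁆ ∈ Subgroup.closure {z | ∃ a ∈ H, ∃ b ∈ (⊤ : Subgroup G), ⁅a, b⁆ = z} :=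
    Subgroup.subset_closure ⟨x, hx, g * h, Subgroup.mem_top _, rfl⟩
  -- The identity is g[x, h]g⁻¹ = [x, g]⁻¹[x, gh]; H need not be normal.
  convert Subgroup.mul_mem _ (Subgroup.inv_mem _ h1) h2 using 1
  simp only [commutatorElement_def]
  group

theorem normal_zpowers_sup {K : Subgroup G} [hK : K.Normal] {x : G}
    (h : ∀ g : G, g * x * g⁻¹ ∈ Subgroup.zpowers x ⊔ K) : (Subgroup.zpowers x ⊔ K).Normal := by
  refine ⟨fun n hn g => ?_⟩
  have : Subgroup.zpowers x ⊔ K ≤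
      (Subgroup.zpowers x ⊔ K).comap (MulAut.conj g).toMonoidHom :=
    sup_le (by rw [Subgroup.zpowers_le]; exact h g)
      fun k hk => Subgroup.mem_sup_right (hK.conj_mem k hk g)
  exact this hn

theorem normal_zpowers_sup_of_commutator_le {K : Subgroup G} [hK : K.Normal] {x : G}
    (h : ⁅Subgroup.zpowers x, (⊤ : Subgroup G)⁆ ≤ K) : (Subgroup.zpowers x ⊔ K).Normal := by
  refine normal_zpowers_sup fun g => ?_
  have h1 : ⁅x, g⁆ ∈ K := h (Subgroup.commutator_mem_commutator (Subgroup.mem_zpowers x)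
    (Subgroup.mem_top g))
  have h2 : x * (x⁻¹ * (⁅x, g⁆)⁻¹ * x) ∈ Subgroup.zpowers x ⊔ K :=
    Subgroup.mul_mem_sup (Subgroup.mem_zpowers x)
      (by simpa using hK.conj_mem _ (K.inv_mem h1) x⁻¹)
  convert h2 using 1
  rw [commutatorElement_def]
  group

/-- A normal subgroup `R` of a nilpotent group not contained in `K` has an element outside `K`
that is central modulo `K`. -/
theorem exists_central_mod {p : ℕ} [Fact p.Prime] [Finite G] {S R K : Subgroup G}
    [hR : R.Normal] (hS : IsPGroup p S) (hRS : R ≤ S) (hRK : ¬ R ≤ K) :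
    ∃ x ∈ R, x ∉ K ∧ ∀ s ∈ S, s * x * s⁻¹ * x⁻¹ ∈ K := by
  classical
  have := hS.isNilpotent
  obtain ⟨n, hn⟩ := Group.IsNilpotent.nilpotent S
  obtain ⟨y, hyR, hyK⟩ := SetLike.not_le_iff_exists.1 hRK
  -- Choose x in the lowest term of the upper central series of S that meets R outside K. Its
  -- commutators with S lie in R and one term lower, hence in K.
  have hex : ∃ n, ∃ x : S, (x : G) ∈ R ∧ (x : G) ∉ K ∧ x ∈ Subgroup.upperCentralSeries S n :=
    ⟨n, ⟨y, hRS hyR⟩, hyR, hyK, hn ▸ Subgroup.mem_top _⟩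
  obtain ⟨x, hxR, hxK, hx⟩ := Nat.find_spec hex
  have hmin := fun m => Nat.find_min hex (m := m)
  generalize Nat.find hex = k at hx hmin
  cases k with
  | zero =>
    rw [Subgroup.upperCentralSeries_zero, Subgroup.mem_bot] at hx
    rw [hx] at hxK
    exact absurd K.one_mem hxK
  | succ k =>
    refine ⟨x, hxR, hxK, fun s hs => ?_⟩
    have h1 := Subgroup.mem_upperCentralSeries_succ_iff.1 hx ⟨s, hs⟩
    have h2 : ((⁅x, (⟨s, hs⟩ : S)⁆ : S) : G) ∈ R := by
      rw [commutatorElement_def]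
      push_cast
      rw [mul_assoc, mul_assoc, ← mul_assoc s]
      exact R.mul_mem hxR (hR.conj_mem _ (R.inv_mem hxR) s)
    by_contra hcon
    refine hmin k (Nat.lt_succ_self k) ⟨_, h2, fun h3 => hcon ?_, h1⟩
    have := K.inv_mem h3
    convert this using 1
    rw [commutatorElement_def]
    push_cast
    group

end Commutator

/-! ### Irreducible modules of abelian groups of exponent dividing p - 1 -/

section Eigenvector

/-- An endomorphism `α` of a nontrivial elementary abelian `p`-group with `α ^ p = α` has an
eigenvector. -/
theorem exists_eigenvector {V : Type*} [CommGroup V] [Finite V] [Nontrivial V] {p : ℕ}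
    [hp : Fact p.Prime] (hV : ∀ v : V, v ^ p = 1) (α : Monoid.End V) (hα : α ^ p = α) :
    ∃ v : V, v ≠ 1 ∧ ∃ i : ℕ, α v = v ^ i := by
  let : Module (ZMod p) (Additive V) := AddCommGroup.zmodModule (n := p) fun v => hV v.toMul
  let f : Module.End (ZMod p) (Additive V) := (MonoidHom.toAdditive α).toZModLinearMap p
  have hfpow : ∀ n : ℕ, ∀ v : V, (f ^ n) (Additive.ofMul v) = Additive.ofMul ((α ^ n) v) := by
    intro n
    induction n with
    | zero => intro v; rfl
    | succ n ih => intro v; rw [pow_succ, pow_succ]; exact ih (α v)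
  have hf : f ^ p = f := by
    refine LinearMap.ext fun v => ?_
    have := hfpow p v.toMul
    rw [hα] at this
    exact this
  -- The minimal polynomial divides X^p - X, which splits over 𝔽_p, so it has a root.
  have hne : (Polynomial.X ^ p - Polynomial.X : Polynomial (ZMod p)) ≠ 0 :=
    FiniteField.X_pow_card_sub_X_ne_zero _ hp.out.one_lt
  have hsplit : (Polynomial.X ^ p - Polynomial.X : Polynomial (ZMod p)).Splits := by
    have := FiniteField.splits_X_pow_card_sub_X (K := ZMod p) p
    simpa using this
  have hdvd : minpoly (ZMod p) f ∣ Polynomial.X ^ p - Polynomial.X :=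
    minpoly.dvd _ _ (by simp [hf])
  have hfin : Module.Finite (ZMod p) (Additive V) := Module.Finite.of_finite
  obtain ⟨μ, hμ⟩ := (hsplit.of_dvd hne hdvd).exists_eval_eq_zero
    (minpoly.degree_pos (Algebra.IsIntegral.isIntegral f)).ne'
  obtain ⟨v, hv⟩ := (Module.End.hasEigenvalue_of_isRoot hμ).exists_hasEigenvector
  refine ⟨v.toMul, hv.2, μ.val, ?_⟩
  have h1 : f v = μ • v := hv.apply_eq_smul
  have h2 : μ • v = μ.val • v := by
    conv_lhs => rw [← ZMod.natCast_zmod_val μ]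
    exact Nat.cast_smul_eq_nsmul _ _ _
  rw [h2] at h1
  exact h1

/-- A minimal normal elementary abelian `p`-subgroup on which the group acts as an abelian group
of exponent dividing `p - 1` is cyclic. -/
theorem exists_zpowers_eq_of_minimal_normal {G : Type*} [Group G] [Finite G] {p : ℕ}
    [hp : Fact p.Prime] (V : Subgroup G) [hV : V.Normal] (hne : V ≠ ⊥)
    (hmin : ∀ W : Subgroup G, W.Normal → W ≤ V → W = ⊥ ∨ W = V)
    (hcomm : ∀ x ∈ V, ∀ y ∈ V, x * y = y * x) (hexp : ∀ x ∈ V, x ^ p = 1)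
    (hder : ∀ g h : G, ∀ x ∈ V, (g * h * g⁻¹ * h⁻¹) * x * (g * h * g⁻¹ * h⁻¹)⁻¹ = x)
    (hpow : ∀ g : G, ∀ x ∈ V, g ^ p * x * (g ^ p)⁻¹ = g * x * g⁻¹) :
    ∃ x ∈ V, Subgroup.zpowers x = V := by
  let : CommGroup V := { (inferInstance : Group V) with
    mul_comm := fun a b => Subtype.ext (hcomm a a.2 b b.2) }
  have hnt : Nontrivial V := (Subgroup.nontrivial_iff_ne_bot V).2 hne
  have key : ∀ g : G, ∃ i : ℕ, ∀ x ∈ V, g * x * g⁻¹ = x ^ i := by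
    intro g
    let α : Monoid.End V := (MulAut.conjNormal (H := V) g).toMonoidHom
    have hα : ∀ v : V, ((α v : V) : G) = g * v * g⁻¹ := fun v => MulAut.conjNormal_apply g v
    have hαn : ∀ n : ℕ, ∀ v : V, (((α ^ n) v : V) : G) = g ^ n * v * (g ^ n)⁻¹ := by
      intro n
      induction n with
      | zero => intro v; simp
      | succ n ih =>
        intro v
        rw [pow_succ, show (α ^ n * α) v = (α ^ n) (α v) from rfl, ih, hα, pow_succ]
        group
    obtain ⟨v, hv1, i, hvi⟩ := exists_eigenvector (p := p)
      (fun v => Subtype.ext (by simpa using hexp v v.2)) α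
      (MonoidHom.ext fun v => Subtype.ext ((hαn p v).trans ((hpow g v v.2).trans (hα v).symm)))
    refine ⟨i, ?_⟩
    -- An eigenspace of g. It is normal because commutators act trivially on V, so by minimality g
    -- acts on V as a scalar.
    let W : Subgroup G :=
      { carrier := {x | x ∈ V ∧ g * x * g⁻¹ = x ^ i}
        one_mem' := ⟨V.one_mem, by simp⟩
        mul_mem' := by
          rintro a b ⟨ha, ha'⟩ ⟨hb, hb'⟩
          refine ⟨V.mul_mem ha hb, ?_⟩
          have hab : Commute a b := hcomm a ha b hb
          rw [hab.mul_pow, ← ha', ← hb']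
          group
        inv_mem' := by
          rintro a ⟨ha, ha'⟩
          refine ⟨V.inv_mem ha, ?_⟩
          rw [inv_pow, ← ha']
          group }
    have hW : W.Normal := by
      refine ⟨?_⟩
      rintro x ⟨hx, hx'⟩ h
      refine ⟨hV.conj_mem x hx h, ?_⟩
      have h1 := hder g h _ (hV.conj_mem _ (hV.conj_mem x hx g) h)
      rw [conj_pow, ← hx']
      refine Eq.trans ?_ h1
      group
    have hWV : W ≤ V := fun x hx => hx.1
    have hvi' : g * v * g⁻¹ = (v : G) ^ i := by
      rw [← hα, hvi]; rfl
    rcases hmin W hW hWV with h | h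
    · have h2 : (v : G) ∈ W := ⟨v.2, hvi'⟩
      rw [h, Subgroup.mem_bot] at h2
      exact absurd (Subtype.ext h2) hv1
    · intro x hx
      rw [← h] at hx
      exact hx.2
  obtain ⟨x, hx, hx1⟩ := V.bot_or_exists_ne_one.resolve_left hne
  refine ⟨x, hx, ?_⟩
  have hle : Subgroup.zpowers x ≤ V := by rwa [Subgroup.zpowers_le]
  have hn : (Subgroup.zpowers x ⊔ (⊥ : Subgroup G)).Normal := by
    refine normal_zpowers_sup fun g => Subgroup.mem_sup_left ?_
    obtain ⟨i, hi⟩ := key g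
    rw [hi x hx]
    exact Subgroup.pow_mem _ (Subgroup.mem_zpowers x) i
  rw [sup_bot_eq] at hn
  rcases hmin _ hn hle with h | h
  · exact absurd (Subgroup.zpowers_eq_bot.1 h) hx1
  · exact h

end Eigenvector

/-! ### Chief factors and the kernel of the action on them -/

section ChiefFactor

variable {G : Type*} [Group G]

theorem IsChiefFactor.sup_eq {L K R : Subgroup G} (h : IsChiefFactor L K) (hR : R.Normal)
    (hRL : R ≤ L) (hRK : ¬ R ≤ K) : R ⊔ K = L := by
  have := h.normal_right
  refine (h.eq_or_eq (R ⊔ K) inferInstance le_sup_right (sup_le hRL h.lt.le)).resolve_left ?_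
  intro h1
  exact hRK (h1 ▸ le_sup_left)

theorem exists_minimal_normal_not_le [Finite G] {L K : Subgroup G} (hL : L.Normal)
    (hLK : ¬ L ≤ K) : ∃ R : Subgroup G, R.Normal ∧ R ≤ L ∧ ¬ R ≤ K ∧
      ∀ R' : Subgroup G, R'.Normal → R' ≤ R → ¬ R' ≤ K → R' = R := by
  obtain ⟨R, hR⟩ := exists_minimal_of_wellFoundedLT
    (fun R : Subgroup G => R.Normal ∧ R ≤ L ∧ ¬ R ≤ K) ⟨L, hL, le_rfl, hLK⟩
  exact ⟨R, hR.1.1, hR.1.2.1, hR.1.2.2, fun R' h1 h2 h3 =>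
    le_antisymm h2 (hR.2 ⟨h1, h2.trans hR.1.2.1, h3⟩ h2)⟩

theorem exists_isChiefFactor_left [Finite G] {C K : Subgroup G} (hC : C.Normal) (hK : K.Normal)
    (hKC : K < C) : ∃ L ≤ C, IsChiefFactor L K := by
  obtain ⟨L, hL⟩ := exists_minimal_of_wellFoundedLT
    (fun L : Subgroup G => L.Normal ∧ L ≤ C ∧ K < L) ⟨C, hC, le_rfl, hKC⟩
  refine ⟨L, hL.1.2.1, hL.1.1, hK, hL.1.2.2, fun M hM hKM hML => ?_⟩
  rcases hKM.eq_or_lt with h | h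
  · exact Or.inl h.symm
  · exact Or.inr (le_antisymm hML (hL.2 ⟨hM, hML.trans hL.1.2.1, h⟩ hML))

theorem exists_isChiefFactor_right [Finite G] {A : Subgroup G} (hA : A.Normal) (hne : A ≠ ⊥) :
    ∃ B, IsChiefFactor A B := by
  obtain ⟨B, hB⟩ := exists_maximal_of_wellFoundedGT
    (fun B : Subgroup G => B.Normal ∧ B < A) ⟨⊥, inferInstance, bot_lt_iff_ne_bot.2 hne⟩
  refine ⟨B, hA, hB.1.1, hB.1.2, fun M hM hBM hMA => ?_⟩
  rcases hMA.eq_or_lt with h | h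
  · exact Or.inr h
  · exact Or.inl (le_antisymm (hB.2 ⟨hM, h⟩ hBM) hBM)

/-- A chief factor that is a section of a normal `p`-subgroup is elementary abelian. -/
theorem IsChiefFactor.elementary [Finite G] {p : ℕ} [Fact p.Prime] {L K : Subgroup G}
    (h : IsChiefFactor L K) (hL : IsPGroup p L) :
    (∀ x ∈ L, x ^ p ∈ K) ∧ ∀ x ∈ L, ∀ y ∈ L, x * y * x⁻¹ * y⁻¹ ∈ K := by
  have hLn := h.normal_left
  have hKn := h.normal_right
  obtain ⟨M, hML, hKM, hMp, hMc⟩ := exists_lt_commutator_pow_mem hL h.lt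
  set S : Set G := {z | ∃ x ∈ L, z = x ^ p} ∪ {z | ∃ x ∈ L, ∃ y ∈ L, z = x * y * x⁻¹ * y⁻¹} with hS
  have hSn : (Subgroup.closure S).Normal := by
    refine ⟨fun x hx s => conj_closure_le ?_ hx⟩
    rintro _ (⟨x, hx, rfl⟩ | ⟨x, hx, y, hy, rfl⟩)
    · exact Subgroup.subset_closure (Or.inl ⟨s * x * s⁻¹, hLn.conj_mem x hx s, by rw [conj_pow]⟩)
    · exact Subgroup.subset_closure (Or.inr ⟨s * x * s⁻¹, hLn.conj_mem x hx s, s * y * s⁻¹,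
        hLn.conj_mem y hy s, by group⟩)
  have hSM : Subgroup.closure S ≤ M := by
    refine (Subgroup.closure_le _).2 ?_
    rintro _ (⟨x, hx, rfl⟩ | ⟨x, hx, y, hy, rfl⟩)
    exacts [hMp x hx, hMc x hx y hy]
  -- Otherwise this normal subgroup and K would generate L, although both lie in M < L.
  have hSK : Subgroup.closure S ≤ K := by
    by_contra hcon
    have := h.sup_eq hSn (hSM.trans hML.le) hcon
    exact hML.not_ge (this ▸ sup_le hSM hKM)
  exact ⟨fun x hx => hSK (Subgroup.subset_closure (Or.inl ⟨x, hx, rfl⟩)),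
    fun x hx y hy => hSK (Subgroup.subset_closure (Or.inr ⟨x, hx, y, hy, rfl⟩))⟩

/-- The intersection of the centralizers of the chief factors of `G` below `Q`. -/
def actionKernel (Q : Subgroup G) : Subgroup G where
  carrier := {g | ∀ A B : Subgroup G, IsChiefFactor A B → A ≤ Q → ∀ a ∈ A, g * a * g⁻¹ * a⁻¹ ∈ B}
  one_mem' A B h _ a _ := by simp
  mul_mem' := by
    intro g h hg hh A B hAB hAQ a ha
    have := hAB.normal_right
    convert B.mul_mem (this.conj_mem _ (hh A B hAB hAQ a ha) g) (hg A B hAB hAQ a ha) using 1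
    group
  inv_mem' := by
    intro g hg A B hAB hAQ a ha
    have := hAB.normal_right
    convert this.conj_mem _ (B.inv_mem (hg A B hAB hAQ a ha)) g⁻¹ using 1
    group

instance (Q : Subgroup G) : (actionKernel Q).Normal := by
  refine ⟨fun g hg h A B hAB hAQ a ha => ?_⟩
  have hB := hAB.normal_right
  have hA := hAB.normal_left
  convert hB.conj_mem _ (hg A B hAB hAQ _ (hA.conj_mem a ha h⁻¹)) h using 1
  group

/-- A `p'`-element acting trivially on all chief factors below `Q` centralizes every normal
`p`-subgroup contained in `Q`. -/
theorem commute_of_mem_actionKernel [Finite G] {p : ℕ} {Q : Subgroup G}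
    {t : G} (ht : (orderOf t).Coprime p) (htQ : t ∈ actionKernel Q) (A : Subgroup G)
    (hA : A.Normal) (hAp : IsPGroup p A) (hAQ : A ≤ Q) : ∀ x ∈ A, Commute t x := by
  induction hn : Nat.card A using Nat.strong_induction_on generalizing A with
  | _ n IH =>
  subst hn
  intro a ha
  by_cases hbot : A = ⊥
  · rw [hbot, Subgroup.mem_bot] at ha
    rw [ha]; exact Commute.one_right t
  obtain ⟨B, hAB⟩ := exists_isChiefFactor_right hA hbot
  have hB := hAB.normal_right
  have hc : a⁻¹ * (t * a * t⁻¹) ∈ B := by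
    convert hB.conj_mem _ (htQ A B hAB hAQ a ha) a⁻¹ using 1
    group
  have hBp : IsPGroup p B := hAp.to_le hAB.lt.le
  obtain ⟨k, hk⟩ := exists_pow_eq_one_of_mem hBp hc
  exact commute_of_commute_commutator ht (by group) hk
    (IH _ (Set.ncard_lt_ncard hAB.lt) B hB hBp (hAB.lt.le.trans hAQ) rfl _ hc)

/-- Every element of `G` acts as a power map on a cyclic chief factor. -/
theorem exists_conj_eq_pow [Finite G] {A B : Subgroup G} [hB : B.Normal] (hA : A.Normal) {x : G}
    (hx : Subgroup.zpowers x ⊔ B = A) (g : G) :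
    ∃ i : ℕ, ∀ a ∈ A, ((g * a * g⁻¹ : G) : G ⧸ B) = (a : G ⧸ B) ^ i := by
  have hmem : ∀ a ∈ A, ∃ j : ℕ, (a : G ⧸ B) = (x : G ⧸ B) ^ j := by
    intro a ha
    rw [← hx, ← SetLike.mem_coe, Subgroup.mul_normal] at ha
    obtain ⟨y, hy, b, hb, rfl⟩ := ha
    obtain ⟨j, rfl⟩ := mem_powers_iff_mem_zpowers.2 hy
    refine ⟨j, ?_⟩
    change ((x ^ j * b : G) : G ⧸ B) = _
    rw [QuotientGroup.mk_mul, (QuotientGroup.eq_one_iff b).2 hb, mul_one, QuotientGroup.mk_pow]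
  have hxA : x ∈ A := hx ▸ Subgroup.mem_sup_left (Subgroup.mem_zpowers x)
  obtain ⟨i, hi⟩ := hmem _ (hA.conj_mem x hxA g)
  refine ⟨i, fun a ha => ?_⟩
  obtain ⟨j, hj⟩ := hmem a ha
  simp only [QuotientGroup.mk_mul, QuotientGroup.mk_inv] at hi ⊢
  rw [hj, ← conj_pow, hi, ← pow_mul, ← pow_mul, mul_comm]

theorem pow_conj_eq_pow {A B : Subgroup G} [hB : B.Normal] (hA : A.Normal) {g : G} {i : ℕ}
    (hi : ∀ a ∈ A, ((g * a * g⁻¹ : G) : G ⧸ B) = (a : G ⧸ B) ^ i) (n : ℕ) :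
    ∀ a ∈ A, ((g ^ n * a * (g ^ n)⁻¹ : G) : G ⧸ B) = (a : G ⧸ B) ^ i ^ n := by
  induction n with
  | zero => intro a _; simp
  | succ n ih =>
    intro a ha
    have h1 := ih _ (hA.conj_mem a ha g)
    rw [hi a ha, ← pow_mul, ← pow_succ'] at h1
    rw [← h1, pow_succ]
    congr 1
    group

theorem mul_inv_mem_iff {B : Subgroup G} [hB : B.Normal] {x y : G} :
    x * y⁻¹ ∈ B ↔ (x : G ⧸ B) = y := by
  rw [← QuotientGroup.eq_one_iff, QuotientGroup.mk_mul, QuotientGroup.mk_inv, mul_inv_eq_one]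

variable [Finite G] {p : ℕ} [hp : Fact p.Prime]

/-- On a cyclic factor every element acts as a power map, and power maps commute. -/
theorem commutator_mem_actionKernel {Q : Subgroup G}
    (hQ : ∀ A B : Subgroup G, IsChiefFactor A B → A ≤ Q → ∃ x, Subgroup.zpowers x ⊔ B = A)
    (g h : G) : g * h * g⁻¹ * h⁻¹ ∈ actionKernel Q := by
  intro A B hAB hAQ a ha
  have hB := hAB.normal_right
  have hA := hAB.normal_left
  obtain ⟨x, hx⟩ := hQ A B hAB hAQ
  obtain ⟨i, hi⟩ := exists_conj_eq_pow hA hx g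
  obtain ⟨j, hj⟩ := exists_conj_eq_pow hA hx h
  rw [mul_inv_mem_iff]
  set b := h⁻¹ * (g⁻¹ * a * g⁻¹⁻¹) * h⁻¹⁻¹ with hb
  have hbA : b ∈ A := hA.conj_mem _ (hA.conj_mem _ ha _) _
  have h1 := hi _ (hA.conj_mem b hbA h)
  rw [hj b hbA] at h1
  have h2 := hj _ (hA.conj_mem b hbA g)
  rw [hi b hbA] at h2
  have h3 : g * (h * b * h⁻¹) * g⁻¹ = a := by rw [hb]; group
  rw [h3] at h1
  set c := g⁻¹ * (h⁻¹ * a * h⁻¹⁻¹) * g⁻¹⁻¹ with hc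
  have hcA : c ∈ A := hA.conj_mem _ (hA.conj_mem _ ha _) _
  have h4 := hi _ (hA.conj_mem c hcA h)
  rw [hj c hcA] at h4
  have h5 := hj _ (hA.conj_mem c hcA g)
  rw [hi c hcA] at h5
  have h6 : h * (g * c * g⁻¹) * h⁻¹ = a := by rw [hc]; group
  rw [h6] at h5
  have h7 : g * (h * c * h⁻¹) * g⁻¹ = g * h * g⁻¹ * h⁻¹ * a * (g * h * g⁻¹ * h⁻¹)⁻¹ := by
    rw [hc]; group
  rw [h7] at h4
  rw [h4, h5, ← pow_mul, ← pow_mul, mul_comm]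

theorem IsChiefFactor.pow_eq_pow {A B : Subgroup G} [hB : B.Normal] (hAB : IsChiefFactor A B)
    (hAp : IsPGroup p A) {i j : ℕ} (hij : i ≡ j [MOD p]) {a : G} (ha : a ∈ A) :
    (a : G ⧸ B) ^ i = (a : G ⧸ B) ^ j := by
  refine pow_eq_pow_iff_modEq.2 (hij.of_dvd (orderOf_dvd_of_pow_eq_one ?_))
  rw [← QuotientGroup.mk_pow]
  exact (QuotientGroup.eq_one_iff _).2 ((hAB.elementary hAp).1 a ha)

theorem IsChiefFactor.modEq_of_pow_eq {A B : Subgroup G} [hB : B.Normal]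
    (hAB : IsChiefFactor A B) (hAp : IsPGroup p A) {i j : ℕ}
    (hij : ∀ a ∈ A, (a : G ⧸ B) ^ i = (a : G ⧸ B) ^ j) : i ≡ j [MOD p] := by
  obtain ⟨a, ha, haB⟩ := SetLike.exists_of_lt hAB.lt
  have h1 := pow_eq_pow_iff_modEq.1 (hij a ha)
  have h2 : orderOf (a : G ⧸ B) = p := by
    refine orderOf_eq_prime ?_ fun h => haB ((QuotientGroup.eq_one_iff _).1 h)
    rw [← QuotientGroup.mk_pow]
    exact (QuotientGroup.eq_one_iff _).2 ((hAB.elementary hAp).1 a ha)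
  rwa [h2] at h1

/-- Fermat's little theorem for the exponent by which g acts. -/
theorem pow_sub_one_mem_actionKernel {Q : Subgroup G} (hQp : IsPGroup p Q)
    (hQ : ∀ A B : Subgroup G, IsChiefFactor A B → A ≤ Q → ∃ x, Subgroup.zpowers x ⊔ B = A)
    (g : G) : g ^ (p - 1) ∈ actionKernel Q := by
  intro A B hAB hAQ a ha
  have hB := hAB.normal_right
  have hA := hAB.normal_left
  have hAp : IsPGroup p A := hQp.to_le hAQ
  obtain ⟨x, hx⟩ := hQ A B hAB hAQ
  obtain ⟨i, hi⟩ := exists_conj_eq_pow hA hx g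
  have hip : i.Coprime p := by
    refine Nat.Coprime.symm ((hp.out.coprime_iff_not_dvd).2 fun hdvd => ?_)
    refine hAB.lt.not_ge fun a ha => ?_
    have h1 := hi a ha
    rw [hAB.pow_eq_pow hAp ((Nat.modEq_zero_iff_dvd).2 hdvd) ha, pow_zero,
      QuotientGroup.eq_one_iff] at h1
    simpa [mul_assoc] using hB.conj_mem _ h1 g⁻¹
  rw [mul_inv_mem_iff, pow_conj_eq_pow hA hi _ a ha]
  have h2 : i ^ (p - 1) ≡ 1 [MOD p] := by
    have := Nat.ModEq.pow_totient hip
    rwa [Nat.totient_prime hp.out] at this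
  rw [hAB.pow_eq_pow hAp h2 ha, pow_one]

/-- If g acts as the i-th power map, then i^(p^k) is congruent modulo p to 1, and also to i by
Fermat. -/
theorem mem_actionKernel_of_pow_eq_one {Q : Subgroup G} (hQp : IsPGroup p Q)
    (hQ : ∀ A B : Subgroup G, IsChiefFactor A B → A ≤ Q → ∃ x, Subgroup.zpowers x ⊔ B = A)
    {g : G} {k : ℕ} (hg : g ^ p ^ k = 1) : g ∈ actionKernel Q := by
  intro A B hAB hAQ a ha
  have hB := hAB.normal_right
  have hA := hAB.normal_left
  have hAp : IsPGroup p A := hQp.to_le hAQ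
  obtain ⟨x, hx⟩ := hQ A B hAB hAQ
  obtain ⟨i, hi⟩ := exists_conj_eq_pow hA hx g
  have h1 : i ^ p ^ k ≡ 1 [MOD p] := hAB.modEq_of_pow_eq hAp fun a ha => by
    rw [← pow_conj_eq_pow hA hi _ a ha, hg]; simp
  have h2 : i ^ p ^ k ≡ i [MOD p] := by
    have : ∀ k : ℕ, i ^ p ^ k ≡ i [MOD p] := by
      intro k
      induction k with
      | zero => simpa using Nat.ModEq.refl i
      | succ k ih =>
        have h3 : i ^ p ≡ i [MOD p] := by
          rw [← ZMod.natCast_eq_natCast_iff, Nat.cast_pow, ZMod.pow_card]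
        rw [pow_succ, pow_mul]
        exact (ih.pow p).trans h3
    exact this k
  rw [mul_inv_mem_iff, hi a ha, hAB.pow_eq_pow hAp (h2.symm.trans h1) ha, pow_one]

end ChiefFactor

/-! ### Chief factors inside normal p-subgroups -/

section Torsion

variable {G : Type*} [Group G] {p e : ℕ}

/-- Every `x ∈ N` with `x ^ e = 1` that lies in `[⟨x⟩, G]` has the property that, for each chief
factor `L / K` with `x ∈ L`, the index of the normalizer of `⟨x⟩K` has no prime divisor but `p`. -/
def TorsionNormalizerIndex (p e : ℕ) (N : Subgroup G) : Prop :=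
  ∀ x ∈ N, x ^ e = 1 → x ∈ ⁅Subgroup.zpowers x, (⊤ : Subgroup G)⁆ →
    ∀ L K : Subgroup G, IsChiefFactor L K → x ∈ L → ∀ q : ℕ, q.Prime →
      q ∣ (Subgroup.normalizer ((Subgroup.zpowers x ⊔ K : Subgroup G) : Set G)).index → q = p

/-- For a minimal normal supplement `R` of `K` in `L` and `x ∈ R`, either `[⟨x⟩, G] ≤ K` or
`x ∈ [⟨x⟩, G]`. -/
theorem commutator_le_or_mem {K R : Subgroup G} (hR : R.Normal)
    (hmin : ∀ R' : Subgroup G, R'.Normal → R' ≤ R → ¬ R' ≤ K → R' = R) {x : G} (hx : x ∈ R) :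
    ⁅Subgroup.zpowers x, (⊤ : Subgroup G)⁆ ≤ K ∨ x ∈ ⁅Subgroup.zpowers x, (⊤ : Subgroup G)⁆ := by
  by_cases h : ⁅Subgroup.zpowers x, (⊤ : Subgroup G)⁆ ≤ K
  · exact Or.inl h
  · right
    have hle : ⁅Subgroup.zpowers x, (⊤ : Subgroup G)⁆ ≤ R :=
      (Subgroup.commutator_mono (Subgroup.zpowers_le.2 hx) le_rfl).trans
        (Subgroup.commutator_le_left R ⊤)
    rw [hmin _ (commutator_top_normal _) hle h]
    exact hx

variable [Finite G] [hp : Fact p.Prime]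

theorem IsChiefFactor.exists_zpowers_sup_eq_of_torsion {N L K R : Subgroup G}
    (hN : TorsionNormalizerIndex p e N) (h : IsChiefFactor L K) (hLN : L ≤ N) (hL : IsPGroup p L)
    (hR : R.Normal) (hRL : R ≤ L) (hRK : ¬ R ≤ K)
    (hmin : ∀ R' : Subgroup G, R'.Normal → R' ≤ R → ¬ R' ≤ K → R' = R)
    (htor : ∀ x ∈ R, x ^ e = 1) : ∃ x, Subgroup.zpowers x ⊔ K = L := by
  have hK := h.normal_right
  have hLn := h.normal_left
  obtain ⟨S, hS⟩ := hL.exists_le_sylow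
  obtain ⟨x, hxR, hxK, hxS⟩ := exists_central_mod (K := K) S.isPGroup' (hRL.trans hS) hRK
  refine ⟨x, ?_⟩
  have hle : Subgroup.zpowers x ⊔ K ≤ L := sup_le (Subgroup.zpowers_le.2 (hRL hxR)) h.lt.le
  suffices hn : (Subgroup.zpowers x ⊔ K).Normal by
    refine (h.eq_or_eq _ hn le_sup_right hle).resolve_left fun h1 => hxK ?_
    rw [← h1]
    exact Subgroup.mem_sup_left (Subgroup.mem_zpowers x)
  -- Either x is central modulo K, or the normalizer of ⟨x⟩K has p-power index and contains S.
  rcases commutator_le_or_mem hR hmin hxR with h1 | h1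
  · exact normal_zpowers_sup_of_commutator_le h1
  · refine normal_of_sylow_le_normalizer _
      (hN x (hLN (hRL hxR)) (htor x hxR) h1 L K h (hRL hxR)) S fun s hs => ?_
    refine Subgroup.mem_normalizer_fintype fun y hy => ?_
    have hconj : Subgroup.zpowers x ⊔ K ≤
        (Subgroup.zpowers x ⊔ K).comap (MulAut.conj s).toMonoidHom := by
      refine sup_le (Subgroup.zpowers_le.2 ?_)
        fun k hk => Subgroup.mem_sup_right (hK.conj_mem k hk s)
      change s * x * s⁻¹ ∈ Subgroup.zpowers x ⊔ K
      have h2 := Subgroup.mul_mem _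
        (Subgroup.mem_sup_right (S := Subgroup.zpowers x) (hxS s hs))
        (Subgroup.mem_sup_left (T := K) (Subgroup.mem_zpowers x))
      simpa using h2
    exact hconj hy

/-- A chief factor below a normal `p`-subgroup centralized by the `p'`-elements of the kernel of
the action on the lower factors is cyclic, if all lower factors are. -/
theorem IsChiefFactor.exists_zpowers_sup_eq_of_trivial {L K : Subgroup G} (h : IsChiefFactor L K)
    (hL : IsPGroup p L)
    (hlow : ∀ A B : Subgroup G, IsChiefFactor A B → A ≤ K → ∃ x, Subgroup.zpowers x ⊔ B = A)
    (htriv : ∀ t ∈ actionKernel K, (orderOf t).Coprime p → ∀ l ∈ L, t * l * t⁻¹ * l⁻¹ ∈ K) :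
    ∃ x, Subgroup.zpowers x ⊔ K = L := by
  have hK := h.normal_right
  have hLn := h.normal_left
  have hKp : IsPGroup p K := hL.to_le h.lt.le
  have hact : ∀ u ∈ actionKernel K, ∀ l ∈ L, u * l * u⁻¹ * l⁻¹ ∈ K := by
    obtain ⟨S₁⟩ : Nonempty (Sylow p (actionKernel K)) := inferInstance
    obtain ⟨S, hS⟩ := (S₁.isPGroup'.map (actionKernel K).subtype).exists_le_sylow
    obtain ⟨x, hxL, hxK, hxS⟩ := exists_central_mod (K := K) S.isPGroup'
      (hL.le_sylow_of_normal S) h.lt.not_ge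
    -- The fixed points of the action kernel on L/K, pulled back to L: a normal subgroup containing
    -- K and x, hence equal to L.
    let F : Subgroup G :=
      { carrier := {l | l ∈ L ∧ ∀ u ∈ actionKernel K, ((u * l : G) : G ⧸ K) = (l * u : G)}
        one_mem' := ⟨L.one_mem, fun u _ => by simp⟩
        mul_mem' := by
          rintro a b ⟨ha, ha'⟩ ⟨hb, hb'⟩
          refine ⟨L.mul_mem ha hb, fun u hu => ?_⟩
          have h1 := ha' u hu
          have h2 := hb' u hu
          simp only [QuotientGroup.mk_mul] at h1 h2 ⊢
          exact Commute.mul_right h1 h2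
        inv_mem' := by
          rintro a ⟨ha, ha'⟩
          refine ⟨L.inv_mem ha, fun u hu => ?_⟩
          have h1 := ha' u hu
          simp only [QuotientGroup.mk_mul, QuotientGroup.mk_inv] at h1 ⊢
          exact Commute.inv_right h1 }
    have hF : F.Normal := by
      refine ⟨?_⟩
      rintro a ⟨ha, ha'⟩ g
      refine ⟨hLn.conj_mem a ha g, fun u hu => ?_⟩
      have h1 := ha' (g⁻¹ * u * g⁻¹⁻¹)
        ((inferInstance : (actionKernel K).Normal).conj_mem u hu g⁻¹)
      simp only [QuotientGroup.mk_mul, QuotientGroup.mk_inv] at h1 ⊢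
      set a' := (a : G ⧸ K)
      set u' := (u : G ⧸ K)
      set g' := (g : G ⧸ K)
      calc u' * (g' * a' * g'⁻¹) = g' * (g'⁻¹ * u' * g'⁻¹⁻¹ * a') * g'⁻¹ := by group
        _ = g' * (a' * (g'⁻¹ * u' * g'⁻¹⁻¹)) * g'⁻¹ := by rw [h1]
        _ = _ := by group
    have hmemF : ∀ u l : G, u * l * u⁻¹ * l⁻¹ ∈ K ↔ ((u * l : G) : G ⧸ K) = (l * u : G) := by
      intro u l
      rw [← mul_inv_mem_iff]
      simp [mul_assoc]
    have hxF : x ∈ F := by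
      refine ⟨hxL, fun u hu => ?_⟩
      let H : Subgroup (actionKernel K) :=
        (Subgroup.centralizer {(x : G ⧸ K)}).comap
          ((QuotientGroup.mk' K).comp (actionKernel K).subtype)
      have hH : ∀ u : actionKernel K, u ∈ H ↔ (u : G) * x * (u : G)⁻¹ * x⁻¹ ∈ K := by
        intro u
        rw [hmemF]
        exact Subgroup.mem_centralizer_singleton_iff
      have htop : H = ⊤ := by
        refine eq_top_of_sylow_le H S₁ (fun s hs => (hH s).2 (hxS s (hS ⟨s, hs, rfl⟩))) ?_
        intro t ht
        exact (hH t).2 (htriv t t.2 (by rwa [Subgroup.orderOf_coe]) x hxL)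
      exact (hmemF u x).1 ((hH ⟨u, hu⟩).1 (htop ▸ Subgroup.mem_top _))
    have hFL : F ≤ L := fun l hl => hl.1
    have hKF : K ≤ F := by
      intro k hk
      refine ⟨h.lt.le hk, fun u _ => ?_⟩
      simp [(QuotientGroup.eq_one_iff k).2 hk]
    have hFeq : F = L := (h.eq_or_eq F hF hKF hFL).resolve_left fun h1 => hxK (h1 ▸ hxF)
    intro u hu l hl
    rw [← hFeq] at hl
    exact (hmemF u l).2 (hl.2 u hu)
  obtain ⟨helP, helC⟩ := h.elementary hL
  let π := QuotientGroup.mk' K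
  have hπ : Function.Surjective π := QuotientGroup.mk'_surjective K
  have hker : π.ker = K := QuotientGroup.ker_mk' K
  have hVn : (L.map π).Normal := hLn.map π hπ
  have hcent : ∀ u ∈ actionKernel K, ∀ v ∈ L.map π, π u * v * (π u)⁻¹ = v := by
    rintro u hu _ ⟨l, hl, rfl⟩
    rw [← map_mul, ← map_inv, ← map_mul]
    exact mul_inv_mem_iff.1 (hact u hu l hl)
  -- Commutators and (p - 1)-th powers lie in the action kernel, which now acts trivially on L/K.
  obtain ⟨v, hv, hvL⟩ := exists_zpowers_eq_of_minimal_normal (p := p) (L.map π)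
    (by
      intro h1
      rw [Subgroup.map_eq_bot_iff, hker] at h1
      exact h.lt.not_ge h1)
    (by
      intro W hW hWL
      have h1 : K ≤ W.comap π := hker.ge.trans (MonoidHom.ker_le_comap _ _)
      have h2 : W.comap π ≤ L := by
        have := Subgroup.comap_mono (f := π) hWL
        rwa [Subgroup.comap_map_eq, hker, sup_eq_left.2 h.lt.le] at this
      have h3 : (W.comap π).map π = W := Subgroup.map_comap_eq_self_of_surjective hπ W
      rcases h.eq_or_eq _ (hW.comap π) h1 h2 with h4 | h4
      · left
        rw [← h3, h4, Subgroup.map_eq_bot_iff, hker]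
      · right
        rw [← h3, h4])
    (by
      rintro _ ⟨a, ha, rfl⟩ _ ⟨b, hb, rfl⟩
      rw [← map_mul, ← map_mul]
      refine mul_inv_mem_iff.1 ?_
      simpa [mul_assoc] using helC a ha b hb)
    (by
      rintro _ ⟨a, ha, rfl⟩
      rw [← map_pow]
      exact (QuotientGroup.eq_one_iff _).2 (helP a ha))
    (by
      intro g h' v hv
      obtain ⟨g, rfl⟩ := hπ g
      obtain ⟨k, rfl⟩ := hπ h'
      have := hcent _ (commutator_mem_actionKernel hlow g k) v hv
      simpa only [map_mul, map_inv] using this)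
    (by
      intro g v hv
      obtain ⟨g, rfl⟩ := hπ g
      have h1 := hcent _ (pow_sub_one_mem_actionKernel hKp hlow g) _ (hVn.conj_mem v hv (π g))
      rw [map_pow] at h1
      refine Eq.trans ?_ h1
      obtain ⟨m, hm⟩ : ∃ m, p = m + 1 := ⟨p - 1, (Nat.sub_add_cancel hp.out.one_le).symm⟩
      rw [hm, Nat.add_sub_cancel, pow_succ]
      group)
  obtain ⟨x, hx, rfl⟩ := hv
  refine ⟨x, ?_⟩
  have h1 : (Subgroup.zpowers x).map π = L.map π := by rw [MonoidHom.map_zpowers]; exact hvL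
  have h2 := congrArg (Subgroup.comap π) h1
  rwa [Subgroup.comap_map_eq, Subgroup.comap_map_eq, hker, sup_eq_left.2 h.lt.le] at h2

/-- All chief factors of `G` below a normal `p`-subgroup of `N` are cyclic. -/
theorem IsChiefFactor.exists_zpowers_sup_eq {N : Subgroup G} (hN : TorsionNormalizerIndex p e N)
    (he : ∀ U ≤ N, IsPGroup p U → TorsionExponent p e U) {L K : Subgroup G}
    (h : IsChiefFactor L K) (hLN : L ≤ N) (hL : IsPGroup p L) :
    ∃ x, Subgroup.zpowers x ⊔ K = L := by
  induction hn : Nat.card L using Nat.strong_induction_on generalizing L K with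
  | _ n IH =>
  subst hn
  have hK := h.normal_right
  have hLn := h.normal_left
  have hKp : IsPGroup p K := hL.to_le h.lt.le
  have hlow : ∀ A B : Subgroup G, IsChiefFactor A B → A ≤ K → ∃ x, Subgroup.zpowers x ⊔ B = A :=
    fun A B hAB hAK => IH _ (Set.ncard_lt_ncard (lt_of_le_of_lt hAK h.lt)) hAB
      (hAK.trans (h.lt.le.trans hLN)) (hKp.to_le hAK) rfl
  by_cases htriv : ∀ t ∈ actionKernel K, (orderOf t).Coprime p → ∀ l ∈ L, t * l * t⁻¹ * l⁻¹ ∈ K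
  · exact h.exists_zpowers_sup_eq_of_trivial hL hlow htriv
  push Not at htriv
  obtain ⟨t₀, ht₀, ht₀p, l₀, hl₀, hcon⟩ := htriv
  set S : Set G := {t | t ∈ actionKernel K ∧ (orderOf t).Coprime p} with hS
  have hTn : (Subgroup.closure S).Normal := by
    refine ⟨fun x hx s => conj_closure_le ?_ hx⟩
    rintro t ⟨ht, htp⟩
    refine Subgroup.subset_closure
      ⟨(inferInstance : (actionKernel K).Normal).conj_mem t ht s, ?_⟩
    have h1 : orderOf (s * t * s⁻¹) = orderOf t :=
      MulEquiv.orderOf_eq (MulAut.conj s) t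
    rwa [h1]
  have hTK : ∀ t ∈ Subgroup.closure S, ∀ k ∈ K, Commute t k := by
    intro t ht k hk
    have : Subgroup.closure S ≤ Subgroup.centralizer {k} := by
      refine (Subgroup.closure_le _).2 ?_
      rintro t ⟨ht, htp⟩
      exact Subgroup.mem_centralizer_singleton_iff.2
        (commute_of_mem_actionKernel htp ht K hK hKp le_rfl k hk)
    exact Subgroup.mem_centralizer_singleton_iff.1 (this ht)
  have ht₀S : t₀ ∈ Subgroup.closure S := Subgroup.subset_closure ⟨ht₀, ht₀p⟩
  have hCK : ¬ ⁅L, Subgroup.closure S⁆ ≤ K := by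
    intro hle
    have h1 := K.inv_mem (hle (Subgroup.commutator_mem_commutator hl₀ ht₀S))
    refine hcon ?_
    convert h1 using 1
    rw [commutatorElement_def]
    group
  obtain ⟨R, hR, hRC, hRK, hmin⟩ :=
    exists_minimal_normal_not_le (Subgroup.commutator_normal L (Subgroup.closure S)) hCK
  have hRL : R ≤ L := hRC.trans (Subgroup.commutator_le_left _ _)
  -- L normalizes K and T centralizes it, so [L, T] centralizes K.
  have hRKc : ∀ r ∈ R, ∀ k ∈ K, Commute r k := by
    intro r hr k hk
    have : ⁅L, Subgroup.closure S⁆ ≤ Subgroup.centralizer {k} := by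
      refine Subgroup.commutator_le.2 fun l _ t ht => ?_
      refine Subgroup.mem_centralizer_singleton_iff.2 ?_
      have h1 : Commute t (l⁻¹ * k * l⁻¹⁻¹) := hTK t ht _ (hK.conj_mem k hk l⁻¹)
      have h2 : Commute t k := hTK t ht k hk
      have h3 : t * (l⁻¹ * k * l⁻¹⁻¹) * t⁻¹ = l⁻¹ * k * l⁻¹⁻¹ := by rw [h1.eq]; group
      have h4 : t⁻¹ * k * t = k := by rw [mul_assoc, ← h2.eq]; group
      rw [commutatorElement_def]
      refine mul_inv_eq_iff_eq_mul.1 ?_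
      calc l * t * l⁻¹ * t⁻¹ * k * (l * t * l⁻¹ * t⁻¹)⁻¹
          = l * (t * (l⁻¹ * (t⁻¹ * k * t) * l⁻¹⁻¹) * t⁻¹) * l⁻¹ := by group
        _ = k := by rw [h4, h3]; group
    exact Subgroup.mem_centralizer_singleton_iff.1 (this (hRC hr))
  obtain ⟨helP, helC⟩ := h.elementary hL
  -- Closed under products: commutators and p-th powers of elements of R lie in K, which commutes
  -- with R.
  let Ω : Subgroup G :=
    { carrier := {x | x ∈ R ∧ x ^ e = 1}
      one_mem' := ⟨R.one_mem, one_pow e⟩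
      mul_mem' := by
        rintro x y ⟨hx, hx'⟩ ⟨hy, hy'⟩
        refine ⟨R.mul_mem hx hy, ?_⟩
        have hc : y⁻¹ * x⁻¹ * y * x ∈ K := by
          simpa using helC _ (L.inv_mem (hRL hy)) _ (L.inv_mem (hRL hx))
        rw [mul_pow_torsionExponent (he L hLN hL) (hRL hx) (hRL hy) (hRKc x hx _ hc)
          (hRKc y hy _ hc) (hRKc y hy _ (helP x (hRL hx))).symm, hx', hy', one_mul]
      inv_mem' := by
        rintro x ⟨hx, hx'⟩
        exact ⟨R.inv_mem hx, by rw [inv_pow, hx', inv_one]⟩ }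
  have hΩn : Ω.Normal := by
    refine ⟨?_⟩
    rintro x ⟨hx, hx'⟩ g
    exact ⟨hR.conj_mem x hx g, by rw [conj_pow, hx']; simp⟩
  have hΩR : Ω ≤ R := fun x hx => hx.1
  -- Otherwise t₀ centralizes Ω, hence R by coprime action, hence L = RK, against the choice of t₀.
  have hΩK : ¬ Ω ≤ K := by
    intro hle
    have h1 := commute_of_commute_torsion ht₀p R (hL.to_le hRL)
      (fun x hx => hR.conj_mem x hx t₀) (he R (hRL.trans hLN) (hL.to_le hRL))
      (fun x hx hxe => hTK t₀ ht₀S x (hle ⟨hx, hxe⟩))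
    have h2 : L ≤ Subgroup.centralizer {t₀} := by
      rw [← h.sup_eq hR hRL hRK]
      refine sup_le (fun r hr => ?_) fun k hk => ?_
      · exact Subgroup.mem_centralizer_singleton_iff.2 (h1 r hr).symm.eq
      · exact Subgroup.mem_centralizer_singleton_iff.2 (hTK t₀ ht₀S k hk).symm.eq
    refine hcon ?_
    rw [← Subgroup.mem_centralizer_singleton_iff.1 (h2 hl₀)]
    simp
  have hΩeq : Ω = R := hmin Ω hΩn hΩR hΩK
  exact h.exists_zpowers_sup_eq_of_torsion hN hLN hL hR hRL hRK hmin
    fun x hx => (hΩeq.symm ▸ hx : x ∈ Ω).2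

end Torsion

/-! ### The case without normal p'-subgroups -/

section Reduced

variable {G : Type*} [Group G] {p e : ℕ}

theorem isPGroup_zpowers {x : G} {k : ℕ} (hx : x ^ p ^ k = 1) : IsPGroup p (Subgroup.zpowers x) :=
  IsPGroup.of_card_dvd_pow (by rw [Nat.card_zpowers]; exact orderOf_dvd_of_pow_eq_one hx)

/-- L/K is G-isomorphic to this factor, since L = (L ∩ Q)K; cyclicity is transferred along it. -/
theorem IsChiefFactor.inf_of_not_le {L K Q : Subgroup G} (h : IsChiefFactor L K) (hQ : Q.Normal)
    (hLQ : ¬ L ⊓ Q ≤ K) : IsChiefFactor (L ⊓ Q) (L ⊓ Q ⊓ K) := by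
  have hL := h.normal_left
  have hK := h.normal_right
  refine ⟨inferInstance, inferInstance,
    lt_of_le_of_ne inf_le_left fun h1 => hLQ (inf_eq_left.1 h1), fun M hM hKM hML => ?_⟩
  by_cases hMK : M ≤ K
  · exact Or.inl (le_antisymm (le_inf hML hMK) hKM)
  · right
    refine le_antisymm hML fun x hx => ?_
    have h1 := h.sup_eq hM (hML.trans inf_le_left) hMK
    have h2 : x ∈ M ⊔ K := by rw [h1]; exact hx.1
    rw [← SetLike.mem_coe, Subgroup.mul_normal] at h2
    obtain ⟨m, hm, k, hk, rfl⟩ := h2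
    refine M.mul_mem hm (hKM ⟨?_, hk⟩)
    simpa using (L ⊓ Q).mul_mem ((L ⊓ Q).inv_mem (hML hm)) hx

variable [Finite G] [hp : Fact p.Prime]

theorem isPGroup_of_coprime_eq_one (h : ∀ t : G, (orderOf t).Coprime p → t = 1) :
    IsPGroup p G := by
  obtain ⟨P⟩ : Nonempty (Sylow p G) := inferInstance
  have htop : (P : Subgroup G) = ⊤ :=
    eq_top_of_sylow_le _ P le_rfl fun t ht => h t ht ▸ (P : Subgroup G).one_mem
  have := P.isPGroup'
  rw [htop] at this
  exact this.of_equiv Subgroup.topEquiv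

theorem coprime_natCard_of_forall_orderOf {H : Type*} [Group H] [Finite H]
    (h : ∀ t : H, (orderOf t).Coprime p) : (Nat.card H).Coprime p := by
  refine Nat.Coprime.symm ((hp.out.coprime_iff_not_dvd).2 fun hdvd => ?_)
  obtain ⟨x, hx⟩ := exists_prime_orderOf_dvd_card' p hdvd
  have := h x
  rw [hx, Nat.coprime_self] at this
  exact hp.out.one_lt.ne' this

theorem exists_maximal_normal_isPGroup (p : ℕ) [Fact p.Prime] (N : Subgroup G) :
    ∃ Q : Subgroup G, Q.Normal ∧ Q ≤ N ∧ IsPGroup p Q ∧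
      ∀ A : Subgroup G, A.Normal → A ≤ N → IsPGroup p A → A ≤ Q := by
  obtain ⟨Q, hQ⟩ := exists_maximal_of_wellFoundedGT
    (fun Q : Subgroup G => Q.Normal ∧ Q ≤ N ∧ IsPGroup p Q)
    ⟨⊥, inferInstance, bot_le, IsPGroup.of_bot⟩
  obtain ⟨hQn, hQN, hQp⟩ := hQ.1
  refine ⟨Q, hQn, hQN, hQp, fun A hA hAN hAp => ?_⟩
  have h1 : (A ⊔ Q).Normal := inferInstance
  exact le_sup_left.trans
    (hQ.2 ⟨h1, sup_le hAN hQN, hAp.to_sup_of_normal_right hQp⟩ le_sup_right)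

/-- If `N` has no nontrivial normal `p'`-subgroup that is normal in `G`, then `N` contains the
centralizer in `N` of its largest `G`-normal `p`-subgroup. -/
theorem centralizer_inf_le {N Q : Subgroup G} (hNn : N.Normal)
    (hN : TorsionNormalizerIndex p e N)
    (he : ∀ U ≤ N, IsPGroup p U → TorsionExponent p e U)
    (hO : ∀ O : Subgroup G, O.Normal → O ≤ N → (Nat.card O).Coprime p → O = ⊥)
    (hQn : Q.Normal) (hQp : IsPGroup p Q)
    (hmax : ∀ A : Subgroup G, A.Normal → A ≤ N → IsPGroup p A → A ≤ Q) :
    Subgroup.centralizer (Q : Set G) ⊓ N ≤ Q := by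
  set C := Subgroup.centralizer (Q : Set G) ⊓ N with hC
  have hCn : C.Normal := inferInstance
  have hCQ : ∀ c ∈ C, ∀ x ∈ Q, Commute c x := fun c hc x hx =>
    (Subgroup.mem_centralizer_iff.1 hc.1 x hx).symm
  by_contra hcon
  have hKC : C ⊓ Q < C := lt_of_le_of_ne inf_le_left fun h => hcon (inf_eq_left.1 h)
  obtain ⟨L, hLC, h⟩ := exists_isChiefFactor_left hCn inferInstance hKC
  obtain ⟨R, hR, hRL, hRK, hmin⟩ := exists_minimal_normal_not_le h.normal_left h.lt.not_ge
  have hRC : R ≤ C := hRL.trans hLC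
  have hRN : R ≤ N := hRC.trans inf_le_right
  have hK := h.normal_right
  have hKp : IsPGroup p (C ⊓ Q : Subgroup G) := hQp.to_inf_right
  have htor : ∀ x ∈ R, x ^ e = 1 → x ∈ Q := by
    intro x hx hxe
    have hxp : x ^ p ^ 2 = 1 := by
      obtain ⟨m, hm⟩ := (he ⊥ bot_le IsPGroup.of_bot).dvd_sq
      rw [hm, pow_mul, hxe, one_pow]
    have hMp : IsPGroup p (Subgroup.zpowers x ⊔ (C ⊓ Q) : Subgroup G) :=
      (isPGroup_zpowers hxp).to_sup_of_normal_right hKp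
    have hMN : Subgroup.zpowers x ⊔ (C ⊓ Q) ≤ N :=
      sup_le (Subgroup.zpowers_le.2 (hRN hx)) (inf_le_left.trans inf_le_right)
    have hxM : x ∈ Subgroup.zpowers x ⊔ (C ⊓ Q) :=
      Subgroup.mem_sup_left (Subgroup.mem_zpowers x)
    -- Either ⟨x⟩(C ∩ Q) is a normal p-subgroup, or all conjugates of x lie in one Sylow p-subgroup
    -- S and the normal closure of x is a p-group.
    rcases commutator_le_or_mem hR hmin hx with h1 | h1
    · exact hmax _ (normal_zpowers_sup_of_commutator_le h1) hMN hMp hxM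
    · obtain ⟨S, hS⟩ := hMp.exists_le_sylow
      have h2 := hN x (hRN hx) hxe h1 L _ h (hRL hx)
      have h3 : Subgroup.normalClosure {x} ≤ S := by
        refine (Subgroup.closure_le _).2 fun y hy => ?_
        obtain ⟨z, hz, hzy⟩ := Group.mem_conjugatesOfSet_iff.1 hy
        rw [Set.mem_singleton_iff.1 hz] at hzy
        obtain ⟨g, rfl⟩ := isConj_iff.1 hzy
        exact conj_mem_sylow _ h2 S hS hxM g
      have h4 : Subgroup.normalClosure {x} ≤ N :=
        Subgroup.normalClosure_le_normal (Set.singleton_subset_iff.2 (hRN hx))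
      exact hmax _ Subgroup.normalClosure_normal h4 (S.isPGroup'.to_le h3)
        (Subgroup.subset_normalClosure (Set.mem_singleton x))
  -- R centralizes Q, which contains all e-torsion of R, so coprime action applies.
  have hloc : LocallyNilpotentAt p R := by
    intro U hU t ht htU x hx
    have hUR : U.map R.subtype ≤ R := Subgroup.map_subtype_le U
    have := commute_of_commute_torsion (p := p) (e := e) (t := (t : G))
      (by rwa [Subgroup.orderOf_coe]) (U.map R.subtype) (hU.map _)
      (by rintro _ ⟨y, hy, rfl⟩; exact ⟨_, htU y hy, rfl⟩)
      (he _ (hUR.trans hRN) (hU.map _))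
      (fun y hy hye => hCQ t (hRC t.2) y (htor y (hUR hy) hye)) x ⟨x, hx, rfl⟩
    exact Subtype.ext this.eq
  obtain ⟨H, hH⟩ := hloc.exists_complement
  have hHn : (H.map R.subtype).Normal := by
    refine ⟨?_⟩
    rintro _ ⟨y, hy, rfl⟩ g
    refine ⟨⟨g * y * g⁻¹, hR.conj_mem y y.2 g⟩, (hH _).2 ?_, rfl⟩
    rw [← Subgroup.orderOf_coe]
    have h1 : orderOf (g * (y : G) * g⁻¹) = orderOf (y : G) :=
      MulEquiv.orderOf_eq (MulAut.conj g) (y : G)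
    rw [h1, Subgroup.orderOf_coe]
    exact (hH y).1 hy
  have hHbot := hO _ hHn ((Subgroup.map_subtype_le H).trans hRN)
    (coprime_natCard_of_forall_orderOf (by
      rintro ⟨_, y, hy, rfl⟩
      have := (hH y).1 hy
      rw [← Subgroup.orderOf_coe] at this ⊢
      exact this))
  have hRp : IsPGroup p R := isPGroup_of_coprime_eq_one fun t ht => by
    have h1 : (t : G) ∈ H.map R.subtype := ⟨t, (hH t).2 ht, rfl⟩
    rw [hHbot, Subgroup.mem_bot] at h1
    exact Subtype.ext h1
  exact hRK (le_inf hRC (hmax R hR hRN hRp))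

/-- The cyclicity of the chief factors of order divisible by `p` below `N`, when `N` contains no
nontrivial `p'`-subgroup that is normal in `G`. -/
theorem IsChiefFactor.exists_zpowers_sup_eq_of_reduced {N : Subgroup G} (hNn : N.Normal)
    (hN : TorsionNormalizerIndex p e N)
    (he : ∀ U ≤ N, IsPGroup p U → TorsionExponent p e U)
    (hO : ∀ O : Subgroup G, O.Normal → O ≤ N → (Nat.card O).Coprime p → O = ⊥)
    {L K : Subgroup G} (h : IsChiefFactor L K) (hLN : L ≤ N) {x : G} {k : ℕ} (hx : x ∈ L)
    (hxK : x ∉ K) (hxp : x ^ p ^ k = 1) : ∃ y, Subgroup.zpowers y ⊔ K = L := by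
  obtain ⟨Q, hQn, hQN, hQp, hmax⟩ := exists_maximal_normal_isPGroup p N
  have hCQ := centralizer_inf_le hNn hN he hO hQn hQp hmax
  have hcyc : ∀ A B : Subgroup G, IsChiefFactor A B → A ≤ Q → ∃ x, Subgroup.zpowers x ⊔ B = A :=
    fun A B hAB hAQ => hAB.exists_zpowers_sup_eq hN he (hAQ.trans hQN) (hQp.to_le hAQ)
  -- A p'-element here centralizes Q, so it lies in C_N(Q) ≤ Q and is trivial.
  have hDp : IsPGroup p (N ⊓ actionKernel Q : Subgroup G) := by
    refine isPGroup_of_coprime_eq_one fun t ht => Subtype.ext ?_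
    rw [← Subgroup.orderOf_coe] at ht
    have htQ : (t : G) ∈ Q := hCQ ⟨Subgroup.mem_centralizer_iff.2 fun y hy =>
      (commute_of_mem_actionKernel ht t.2.2 Q hQn hQp le_rfl y hy).symm.eq, t.2.1⟩
    obtain ⟨j, hj⟩ := exists_pow_eq_one_of_mem hQp htQ
    have h1 := pow_gcd_eq_one.2 ⟨pow_orderOf_eq_one (t : G), hj⟩
    rwa [(ht.pow_right j).gcd_eq_one, pow_one] at h1
  have hxQ : x ∈ Q := hmax _ inferInstance inf_le_left hDp
    ⟨hLN hx, mem_actionKernel_of_pow_eq_one hQp hcyc hxp⟩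
  have hLQ : ¬ L ⊓ Q ≤ K := fun hle => hxK (hle ⟨hx, hxQ⟩)
  have hL := h.normal_left
  obtain ⟨y, hy⟩ := hcyc _ _ (h.inf_of_not_le hQn hLQ) inf_le_right
  refine ⟨y, ?_⟩
  have h1 := h.sup_eq (R := L ⊓ Q) inferInstance inf_le_left hLQ
  rw [← hy, sup_assoc, sup_eq_right.2 (inf_le_right : L ⊓ Q ⊓ K ≤ K)] at h1
  exact h1

end Reduced

/-! ### Passing to the quotient by a normal p'-subgroup -/

section Quotient

variable {G : Type*} [Group G]

theorem inv_mul_mem_ker {G' : Type*} [Group G'] {f : G →* G'} {a b : G} (h : f a = f b) :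
    a⁻¹ * b ∈ f.ker := by
  rw [MonoidHom.mem_ker, map_mul, map_inv, h, inv_mul_cancel]

theorem pow_natCard_eq_one_of_mem {H : Subgroup G} {x : G} (hx : x ∈ H) : x ^ Nat.card H = 1 :=
  congrArg Subtype.val (pow_card_eq_one' (x := (⟨x, hx⟩ : H)))

theorem index_normalizer_comap {G' : Type*} [Group G'] {f : G →* G'} (hf : Function.Surjective f)
    (H : Subgroup G') : (Subgroup.normalizer ((H.comap f : Subgroup G) : Set G)).index =
      (Subgroup.normalizer (H : Set G')).index := by
  rw [← Subgroup.comap_normalizer_eq_of_surjective H hf,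
    Subgroup.index_comap_of_surjective _ hf]

theorem IsChiefFactor.comap {G' : Type*} [Group G'] {f : G →* G'} (hf : Function.Surjective f)
    {L K : Subgroup G'} (h : IsChiefFactor L K) : IsChiefFactor (L.comap f) (K.comap f) := by
  have hL := h.normal_left
  have hK := h.normal_right
  refine ⟨inferInstance, inferInstance, (Subgroup.comap_lt_comap_of_surjective hf).2 h.lt,
    fun M hM hKM hML => ?_⟩
  have h1 : (M.map f).comap f = M :=
    (Subgroup.comap_map_eq f M).trans
      (sup_eq_left.2 ((MonoidHom.ker_le_comap f K).trans hKM))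
  have h2 : K ≤ M.map f := by
    rw [← Subgroup.map_comap_eq_self_of_surjective hf K]; exact Subgroup.map_mono hKM
  have h3 : M.map f ≤ L := Subgroup.map_le_iff_le_comap.2 hML
  rcases h.eq_or_eq _ (hM.map f hf) h2 h3 with h4 | h4
  · left; rw [← h1, h4]
  · right; rw [← h1, h4]

theorem IsChiefFactor.map {G' : Type*} [Group G'] {f : G →* G'} (hf : Function.Surjective f)
    {L K : Subgroup G} (h : IsChiefFactor L K) (hker : L ⊓ f.ker ≤ K) :
    IsChiefFactor (L.map f) (K.map f) := by
  have hL := h.normal_left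
  have hK := h.normal_right
  have key : ∀ x ∈ L, f x ∈ K.map f → x ∈ K := by
    rintro x hx ⟨k, hk, hkx⟩
    have h1 : k⁻¹ * x ∈ K := hker ⟨L.mul_mem (L.inv_mem (h.lt.le hk)) hx, inv_mul_mem_ker hkx⟩
    simpa using K.mul_mem hk h1
  refine ⟨hL.map f hf, hK.map f hf, lt_of_le_of_ne (Subgroup.map_mono h.lt.le) fun h1 => ?_,
    fun M hM hKM hML => ?_⟩
  · exact h.lt.not_ge fun x hx => key x hx (h1 ▸ ⟨x, hx, rfl⟩)
  · have hn : (M.comap f ⊓ L).Normal := by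
      have := hM.comap f
      infer_instance
    rcases h.eq_or_eq _ hn (le_inf (Subgroup.map_le_iff_le_comap.1 hKM) h.lt.le) inf_le_right
      with h1 | h1
    · left
      refine le_antisymm (fun y hy => ?_) hKM
      obtain ⟨l, hl, rfl⟩ := hML hy
      exact ⟨l, h1 ▸ (⟨hy, hl⟩ : l ∈ M.comap f ⊓ L), rfl⟩
    · right
      exact le_antisymm hML (Subgroup.map_le_iff_le_comap.2 (inf_eq_right.1 h1))

theorem exists_maximal_normal_coprime [Finite G] (p : ℕ) (N : Subgroup G) :
    ∃ O : Subgroup G, O.Normal ∧ O ≤ N ∧ (Nat.card O).Coprime p ∧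
      ∀ A : Subgroup G, A.Normal → A ≤ N → (Nat.card A).Coprime p → O ≤ A → A ≤ O := by
  obtain ⟨O, hO⟩ := exists_maximal_of_wellFoundedGT
    (fun O : Subgroup G => O.Normal ∧ O ≤ N ∧ (Nat.card O).Coprime p)
    ⟨⊥, inferInstance, bot_le, by simp⟩
  exact ⟨O, hO.1.1, hO.1.2.1, hO.1.2.2, fun A h1 h2 h3 h4 => hO.2 ⟨h1, h2, h3⟩ h4⟩

variable {p e : ℕ}

theorem TorsionNormalizerIndex.map_mk {N O : Subgroup G} [hO : O.Normal]
    (hcop : (Nat.card O).Coprime e) (hN : TorsionNormalizerIndex p e N) :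
    TorsionNormalizerIndex p e (N.map (QuotientGroup.mk' O)) := by
  rintro _ ⟨y, hy, rfl⟩ hxe hxc L K h hxL q hq hdvd
  set π := QuotientGroup.mk' O with hπdef
  have hπ : Function.Surjective π := QuotientGroup.mk'_surjective O
  have hker : π.ker = O := QuotientGroup.ker_mk' O
  -- With m divisible by |O| and congruent to 1 modulo e, the power y^m has the same image as y and
  -- is itself killed by e.
  obtain ⟨m, hm0, hm1⟩ := Nat.chineseRemainder hcop 0 1
  obtain ⟨c, rfl⟩ := (Nat.modEq_zero_iff_dvd).1 hm0
  set x := y ^ (Nat.card O * c) with hx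
  have hyO : y ^ e ∈ O := by
    rw [← hker, MonoidHom.mem_ker, map_pow, hxe]
  have hxe' : x ^ e = 1 := by
    rw [hx, ← pow_mul, mul_comm, pow_mul, pow_mul, pow_natCard_eq_one_of_mem hyO, one_pow]
  have hπx : π x = π y := by
    rw [hx, map_pow]
    conv_rhs => rw [← pow_one (π y)]
    exact pow_eq_pow_iff_modEq.2 (hm1.of_dvd (orderOf_dvd_of_pow_eq_one hxe))
  rw [← hπx] at hxc hxL hdvd
  have hRn : (⁅Subgroup.zpowers x, (⊤ : Subgroup G)⁆).Normal := commutator_top_normal _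
  have hxR : x ∈ ⁅Subgroup.zpowers x, (⊤ : Subgroup G)⁆ := by
    have h1 : ⁅Subgroup.zpowers (π x), (⊤ : Subgroup (G ⧸ O))⁆ =
        (⁅Subgroup.zpowers x, (⊤ : Subgroup G)⁆).map π := by
      rw [Subgroup.map_commutator, MonoidHom.map_zpowers, Subgroup.map_top_of_surjective π hπ]
    rw [h1] at hxc
    obtain ⟨r, hr, hrx⟩ := hxc
    have ho : r⁻¹ * x ∈ O := hker.le (inv_mul_mem_ker hrx)
    -- Modulo [⟨x⟩, G], x equals an element of O, so its order there divides both |O| and e.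
    have h2 : (x : G ⧸ ⁅Subgroup.zpowers x, (⊤ : Subgroup G)⁆) = ((r⁻¹ * x : G) : G ⧸ _) := by
      rw [QuotientGroup.mk_mul, QuotientGroup.mk_inv, (QuotientGroup.eq_one_iff r).2 hr, inv_one,
        one_mul]
    have h3 : (x : G ⧸ ⁅Subgroup.zpowers x, (⊤ : Subgroup G)⁆) ^ Nat.card O = 1 := by
      rw [h2, ← QuotientGroup.mk_pow, pow_natCard_eq_one_of_mem ho, QuotientGroup.mk_one]
    have h4 : (x : G ⧸ ⁅Subgroup.zpowers x, (⊤ : Subgroup G)⁆) ^ e = 1 := by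
      rw [← QuotientGroup.mk_pow, hxe', QuotientGroup.mk_one]
    have h5 := pow_gcd_eq_one.2 ⟨h3, h4⟩
    rw [hcop.gcd_eq_one, pow_one] at h5
    exact (QuotientGroup.eq_one_iff _).1 h5
  refine hN x (N.pow_mem hy _) hxe' hxR _ _ (h.comap hπ) hxL q hq ?_
  have h6 : Subgroup.zpowers x ⊔ K.comap π = (Subgroup.zpowers (π x) ⊔ K).comap π := by
    have h7 : Subgroup.zpowers (π x) ⊔ K = (Subgroup.zpowers x ⊔ K.comap π).map π := by
      rw [Subgroup.map_sup, MonoidHom.map_zpowers, Subgroup.map_comap_eq_self_of_surjective hπ]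
    rw [h7, Subgroup.comap_map_eq]
    exact (sup_eq_left.2 ((MonoidHom.ker_le_comap π K).trans le_sup_right)).symm
  rw [h6, index_normalizer_comap hπ]
  exact hdvd

variable [Finite G] [hp : Fact p.Prime]

/-- A p-subgroup of the quotient is the image of a Sylow p-subgroup of its preimage, and
commutativity passes to images. -/
theorem torsionExponent_map_mk {N O : Subgroup G} [hO : O.Normal] (hON : O ≤ N)
    (he : ∀ U ≤ N, IsPGroup p U → TorsionExponent p e U) :
    ∀ U ≤ N.map (QuotientGroup.mk' O), IsPGroup p U → TorsionExponent p e U := by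
  intro U hUN hU
  set π := QuotientGroup.mk' O with hπdef
  have hπ : Function.Surjective π := QuotientGroup.mk'_surjective O
  have hker : π.ker = O := QuotientGroup.ker_mk' O
  have hle : U.comap π ≤ N := by
    have := Subgroup.comap_mono (f := π) hUN
    rwa [Subgroup.comap_map_eq, sup_eq_left.2 (hker.le.trans hON)] at this
  obtain ⟨S⟩ : Nonempty (Sylow p (U.comap π)) := inferInstance
  have hsurj := MonoidHom.subgroupComap_surjective_of_surjective π U hπ
  have htop : ((S.mapSurjective hsurj : Sylow p U) : Subgroup U) = ⊤ :=
    ((S.mapSurjective hsurj).is_maximal' (hU.to_subgroup ⊤) le_top).symm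
  have hmem : ∀ u ∈ U, ∃ s ∈ (S : Subgroup (U.comap π)).map (U.comap π).subtype, π s = u := by
    intro u hu
    have h1 : (⟨u, hu⟩ : U) ∈ ((S.mapSurjective hsurj : Sylow p U) : Subgroup U) :=
      htop ▸ Subgroup.mem_top _
    rw [Sylow.coe_mapSurjective] at h1
    obtain ⟨s, hs, hsu⟩ := h1
    exact ⟨s, ⟨s, hs, rfl⟩, congrArg Subtype.val hsu⟩
  refine (he _ ((Subgroup.map_subtype_le _).trans hle) (S.isPGroup'.map _)).imp
    (fun h => ⟨h.1, fun h2 x hx y hy => ?_⟩) id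
  obtain ⟨s, hs, rfl⟩ := hmem x hx
  obtain ⟨t, ht, rfl⟩ := hmem y hy
  rw [← map_mul, ← map_mul, h.2 h2 s hs t ht]

/-- A chief factor of `G` below `N` that contains a nontrivial `p`-element is cyclic. -/
theorem IsChiefFactor.exists_zpowers_sup_eq_of_mem {N : Subgroup G} (hNn : N.Normal)
    (hN : TorsionNormalizerIndex p e N)
    (he : ∀ U ≤ N, IsPGroup p U → TorsionExponent p e U)
    {L K : Subgroup G} (h : IsChiefFactor L K) (hLN : L ≤ N) {x : G} {k : ℕ} (hx : x ∈ L)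
    (hxK : x ∉ K) (hxp : x ^ p ^ k = 1) : ∃ y, Subgroup.zpowers y ⊔ K = L := by
  obtain ⟨O, hO, hON, hcop, hmax⟩ := exists_maximal_normal_coprime p N
  set π := QuotientGroup.mk' O with hπdef
  have hπ : Function.Surjective π := QuotientGroup.mk'_surjective O
  have hker : π.ker = O := QuotientGroup.ker_mk' O
  have hL := h.normal_left
  have hK := h.normal_right
  have hmemO : ∀ z ∈ O, ∀ j, z ^ p ^ j = 1 → z = 1 := by
    intro z hz j hj
    have h2 := pow_gcd_eq_one.2 ⟨pow_natCard_eq_one_of_mem hz, hj⟩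
    rwa [(hcop.pow_right j).gcd_eq_one, pow_one] at h2
  -- Otherwise L = (L ∩ O)K, and L/K would be a p'-group containing the nontrivial p-element xK.
  have hLO : L ⊓ O ≤ K := by
    by_contra hcon
    have h1 := h.sup_eq (R := L ⊓ O) inferInstance inf_le_left hcon
    rw [← h1, ← SetLike.mem_coe, Subgroup.mul_normal] at hx
    obtain ⟨o, ho, c, hc, rfl⟩ := hx
    have h2 : ((o * c : G) : G ⧸ K) = o := by
      rw [QuotientGroup.mk_mul, (QuotientGroup.eq_one_iff c).2 hc, mul_one]
    have h3 : (o : G ⧸ K) ^ p ^ k = 1 := by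
      rw [← h2, ← QuotientGroup.mk_pow, hxp, QuotientGroup.mk_one]
    have h4 : (o : G ⧸ K) ^ Nat.card O = 1 := by
      rw [← QuotientGroup.mk_pow, pow_natCard_eq_one_of_mem ho.2, QuotientGroup.mk_one]
    have h5 := pow_gcd_eq_one.2 ⟨h4, h3⟩
    rw [(hcop.pow_right k).gcd_eq_one, pow_one, ← h2] at h5
    exact hxK ((QuotientGroup.eq_one_iff _).1 h5)
  have key : ∀ x ∈ L, π x ∈ K.map π → x ∈ K := by
    rintro x hx ⟨c, hc, hcx⟩
    have h1 : c⁻¹ * x ∈ K := hLO ⟨L.mul_mem (L.inv_mem (h.lt.le hc)) hx, hker.le (inv_mul_mem_ker hcx)⟩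
    simpa using K.mul_mem hc h1
  have he2 : e ∣ p ^ 2 := (he ⊥ bot_le IsPGroup.of_bot).dvd_sq
  obtain ⟨z, hz⟩ := IsChiefFactor.exists_zpowers_sup_eq_of_reduced (p := p) (e := e)
    (hNn.map π hπ) (hN.map_mk (Nat.Coprime.coprime_dvd_right he2 (hcop.pow_right 2)))
    (torsionExponent_map_mk hON he)
    (by
      intro A hA hAN hAc
      have h1 : A.comap π ≤ N := by
        have := Subgroup.comap_mono (f := π) hAN
        rwa [Subgroup.comap_map_eq, sup_eq_left.2 (hker.le.trans hON)] at this
      have h2 : (Nat.card (A.comap π)).Coprime p := by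
        refine Nat.Coprime.symm ((hp.out.coprime_iff_not_dvd).2 fun hdvd => ?_)
        obtain ⟨y, hy⟩ := exists_prime_orderOf_dvd_card' p hdvd
        rw [← Subgroup.orderOf_coe] at hy
        have hyp : (y : G) ^ p = 1 := by rw [← hy, pow_orderOf_eq_one]
        have h3 : π (y : G) ^ p = 1 := by rw [← map_pow, hyp, map_one]
        have h4 : π (y : G) ^ Nat.card A = 1 := pow_natCard_eq_one_of_mem y.2
        have h5 := pow_gcd_eq_one.2 ⟨h4, h3⟩
        rw [hAc.gcd_eq_one, pow_one, ← MonoidHom.mem_ker, hker] at h5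
        have h6 := hmemO y h5 1 (by rw [pow_one, hyp])
        rw [h6, orderOf_one] at hy
        exact hp.out.one_lt.ne hy
      have h3 := hmax _ (hA.comap π) h1 h2 (hker.ge.trans (MonoidHom.ker_le_comap π A))
      rw [← Subgroup.map_comap_eq_self_of_surjective hπ A, Subgroup.map_eq_bot_iff, hker]
      exact h3)
    (h.map hπ (hker.symm ▸ hLO)) (Subgroup.map_mono hLN) (k := k) ⟨x, hx, rfl⟩
    (fun h1 => hxK (key x hx h1)) (by rw [← map_pow, hxp, map_one])
  have hzL : z ∈ L.map π := hz ▸ Subgroup.mem_sup_left (Subgroup.mem_zpowers z)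
  obtain ⟨y, hy, rfl⟩ := hzL
  refine ⟨y, le_antisymm (sup_le (Subgroup.zpowers_le.2 hy) h.lt.le) fun l hl => ?_⟩
  have h1 : π l ∈ (Subgroup.zpowers y ⊔ K).map π := by
    rw [Subgroup.map_sup, MonoidHom.map_zpowers, hz]
    exact ⟨l, hl, rfl⟩
  obtain ⟨w, hw, hwl⟩ := h1
  have hwL : w ∈ L := (sup_le (Subgroup.zpowers_le.2 hy) h.lt.le : Subgroup.zpowers y ⊔ K ≤ L) hw
  have h2 : w⁻¹ * l ∈ K := hLO ⟨L.mul_mem (L.inv_mem hwL) hl, hker.le (inv_mul_mem_ker hwl)⟩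
  have h3 := Subgroup.mul_mem _ hw (Subgroup.mem_sup_right (S := Subgroup.zpowers y) h2)
  simpa using h3

end Quotient

/-! ### From the IC-Π-property to cyclic chief factors -/

section ChiefFactorsCyclic

variable {G : Type*} [Group G] {p e : ℕ} [hp : Fact p.Prime]

/-- As ⟨y⟩ ≤ [⟨y⟩, G] and y ∈ L, the Π-property concerns the image of ⟨y⟩ in G/K, a p-group whose
preimage is ⟨y⟩K. -/
theorem ICPiProperty.eq_of_dvd_index {y : G} (hy : ICPiProperty (Subgroup.zpowers y))
    (hyc : y ∈ ⁅Subgroup.zpowers y, (⊤ : Subgroup G)⁆) {k : ℕ} (hyp : y ^ p ^ k = 1)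
    {L K : Subgroup G} (h : IsChiefFactor L K) (hyL : y ∈ L) {q : ℕ} (hq : q.Prime)
    (hdvd : q ∣ (Subgroup.normalizer ((Subgroup.zpowers y ⊔ K : Subgroup G) : Set G)).index) :
    q = p := by
  have hK := h.normal_right
  rw [ICPiProperty, inf_eq_left.2 (Subgroup.zpowers_le.2 hyc)] at hy
  have h1 := hy L K h q hq
  have h2 : quot (Subgroup.zpowers y) K ⊓ quot L K =
      Subgroup.zpowers ((QuotientGroup.mk' K) y) := by
    rw [quot, quot, inf_eq_left.2 (Subgroup.map_mono (Subgroup.zpowers_le.2 hyL)),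
      MonoidHom.map_zpowers]
  rw [h2] at h1
  have h3 : (Subgroup.zpowers ((QuotientGroup.mk' K) y)).comap (QuotientGroup.mk' K) =
      Subgroup.zpowers y ⊔ K := by
    rw [← MonoidHom.map_zpowers, Subgroup.comap_map_eq, QuotientGroup.ker_mk']
  rw [← h3, index_normalizer_comap (QuotientGroup.mk'_surjective K)] at hdvd
  obtain ⟨-, h4⟩ := h1 hdvd
  rw [Nat.card_zpowers] at h4
  have h5 : orderOf ((QuotientGroup.mk' K) y) ∣ p ^ k :=
    orderOf_dvd_of_pow_eq_one (by rw [← map_pow, hyp, map_one])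
  exact (Nat.prime_dvd_prime_iff_eq hq hp.out).1 (hq.dvd_of_dvd_pow (h4.trans h5))

/-- The property of `x` in `TorsionNormalizerIndex` follows from the `IC`-`Π`-property of the
subgroup generated by a conjugate of `x`. -/
theorem eq_of_dvd_index_of_conj {x g : G}
    (hg : ICPiProperty (Subgroup.zpowers (g * x * g⁻¹)))
    (hxc : x ∈ ⁅Subgroup.zpowers x, (⊤ : Subgroup G)⁆) {k : ℕ} (hxp : x ^ p ^ k = 1)
    {L K : Subgroup G} (h : IsChiefFactor L K) (hxL : x ∈ L) {q : ℕ} (hq : q.Prime)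
    (hdvd : q ∣ (Subgroup.normalizer ((Subgroup.zpowers x ⊔ K : Subgroup G) : Set G)).index) :
    q = p := by
  have hK := h.normal_right
  have hL := h.normal_left
  let φ : G →* G := (MulAut.conj g).toMonoidHom
  have hφ : Function.Surjective φ := (MulAut.conj g).surjective
  have hmap : (Subgroup.zpowers x).map φ = Subgroup.zpowers (g * x * g⁻¹) :=
    MonoidHom.map_zpowers φ x
  have hcomap : (Subgroup.zpowers (g * x * g⁻¹) ⊔ K).comap φ = Subgroup.zpowers x ⊔ K := by
    have h1 : K.map φ = K := by
      refine le_antisymm ?_ fun c hc => ⟨g⁻¹ * c * g⁻¹⁻¹, hK.conj_mem c hc g⁻¹, ?_⟩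
      · rintro _ ⟨c, hc, rfl⟩
        exact hK.conj_mem c hc g
      · change g * (g⁻¹ * c * g⁻¹⁻¹) * g⁻¹ = c
        group
    rw [← hmap]
    conv_lhs => rw [← h1]
    rw [← Subgroup.map_sup]
    exact Subgroup.comap_map_eq_self_of_injective (MulAut.conj g).injective _
  rw [← hcomap, index_normalizer_comap hφ] at hdvd
  refine hg.eq_of_dvd_index ?_ (k := k) ?_ h (hL.conj_mem x hxL g) hq hdvd
  · have h1 : φ x ∈ (⁅Subgroup.zpowers x, (⊤ : Subgroup G)⁆).map φ := ⟨x, hxc, rfl⟩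
    rwa [Subgroup.map_commutator, hmap, Subgroup.map_top_of_surjective φ hφ] at h1
  · rw [conj_pow, hxp]
    simp

variable [Finite G]

theorem exists_pow_mem_notMem {L K : Subgroup G} [K.Normal] (h : p ∣ Nat.card (quot L K)) :
    ∃ x ∈ L, x ∉ K ∧ ∃ k : ℕ, x ^ p ^ k = 1 := by
  obtain ⟨⟨_, l, hl, rfl⟩, hv⟩ := exists_prime_orderOf_dvd_card' p h
  rw [← Subgroup.orderOf_coe] at hv
  -- The p'-part m of the order of l: l^m is a p-element, and it stays outside K because the image
  -- of l has order p.
  obtain ⟨k, m, hm, hkm⟩ := Nat.exists_eq_pow_mul_and_not_dvd (orderOf_pos l).ne' p hp.out.ne_one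
  refine ⟨l ^ m, L.pow_mem hl m, fun hK => hm ?_, k, ?_⟩
  · rw [← hv]
    refine orderOf_dvd_of_pow_eq_one ?_
    rw [← map_pow]
    exact (QuotientGroup.eq_one_iff _).2 hK
  · rw [← pow_mul, mul_comm, ← hkm, pow_orderOf_eq_one]

theorem pChiefFactorsCyclicBelow_of_torsionNormalizerIndex {N : Subgroup G} (hNn : N.Normal)
    (hN : TorsionNormalizerIndex p e N)
    (he : ∀ U ≤ N, IsPGroup p U → TorsionExponent p e U) : PChiefFactorsCyclicBelow p N := by
  intro L K _ h hLN hdvd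
  obtain ⟨x, hx, hxK, k, hk⟩ := exists_pow_mem_notMem hdvd
  obtain ⟨y, hy⟩ := h.exists_zpowers_sup_eq_of_mem hNn hN he hLN hx hxK hk
  have h1 : quot L K = Subgroup.zpowers ((QuotientGroup.mk' K) y) := by
    rw [quot, ← hy, Subgroup.map_sup, MonoidHom.map_zpowers,
      (Subgroup.map_eq_bot_iff _).2 (QuotientGroup.ker_mk' K).ge, sup_bot_eq]
  rw [h1]
  infer_instance

end ChiefFactorsCyclic

end ICPi

/-! ### The main theorem -/

theorem theoremC {G : Type*} [Group G] [Finite G] (p : ℕ) [Fact p.Prime]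
    (N : Subgroup G) [N.Normal] (P : Sylow p N)
    (h_order_p : ∀ H : Subgroup G, H ≤ (P : Subgroup N).map N.subtype →
      Nat.card H = p → ICPi.ICPiProperty H)
    (h_order_four : p = 2 → (¬ ∀ x ∈ P, ∀ y ∈ P, x * y = y * x) →
      ∀ H : Subgroup G, H ≤ (P : Subgroup N).map N.subtype →
        IsCyclic H → Nat.card H = 4 → ICPi.ICPiProperty H) :
    N ≤ ICPi.pSupersolubleHypercenter p G := by
  have hp : p.Prime := Fact.out
  have hconj : ∀ U : Subgroup N, IsPGroup p U →
      ∃ n : N, ∀ u ∈ U, n * u * n⁻¹ ∈ (P : Subgroup N) := by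
    intro U hU
    obtain ⟨S, hS⟩ := hU.exists_le_sylow
    obtain ⟨n, hn⟩ := MulAction.exists_smul_eq N S P
    refine ⟨n, fun u hu => ?_⟩
    rw [← hn]
    exact ⟨u, hS hu, rfl⟩
  obtain ⟨e, he2, hcases⟩ : ∃ e : ℕ, e ∣ p ^ 2 ∧
      ((e = p ∧ (p = 2 → ∀ x ∈ P, ∀ y ∈ P, x * y = y * x)) ∨
        (p = 2 ∧ e = 4 ∧ ¬ ∀ x ∈ P, ∀ y ∈ P, x * y = y * x)) := by
    by_cases hc : p = 2 → ∀ x ∈ P, ∀ y ∈ P, x * y = y * x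
    · exact ⟨p, dvd_pow_self p two_ne_zero, Or.inl ⟨rfl, hc⟩⟩
    · rw [Classical.not_imp] at hc
      exact ⟨4, by rw [hc.1]; norm_num, Or.inr ⟨hc.1, rfl, hc.2⟩⟩
  refine le_sSup ⟨inferInstance, ICPi.pChiefFactorsCyclicBelow_of_torsionNormalizerIndex
    (e := e) inferInstance ?_ ?_⟩
  · intro x hxN hxe hxc L K h hxL q hq hdvd
    have hxp : x ^ p ^ 2 = 1 := by
      obtain ⟨m, hm⟩ := he2
      rw [hm, pow_mul, hxe, one_pow]
    -- The hypotheses only concern subgroups of P, so x is first conjugated into P.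
    obtain ⟨n, hn⟩ := hconj (Subgroup.zpowers ⟨x, hxN⟩)
      (ICPi.isPGroup_zpowers (k := 2) (Subtype.ext (by simpa using hxp)))
    have hyP : Subgroup.zpowers ((n : G) * x * (n : G)⁻¹) ≤ (P : Subgroup N).map N.subtype :=
      Subgroup.zpowers_le.2 ⟨_, hn _ (Subgroup.mem_zpowers _), rfl⟩
    have hord : orderOf ((n : G) * x * (n : G)⁻¹) = orderOf x :=
      MulEquiv.orderOf_eq (MulAut.conj (n : G)) x
    by_cases hx1 : x = 1
    · have hK := h.normal_right
      rw [hx1, Subgroup.zpowers_one_eq_bot, bot_sup_eq, Subgroup.normalizer_eq_top,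
        Subgroup.index_top] at hdvd
      exact absurd (Nat.dvd_one.1 hdvd) hq.ne_one
    · refine ICPi.eq_of_dvd_index_of_conj (g := (n : G)) ?_ hxc hxp h hxL hq hdvd
      rcases hcases with ⟨rfl, -⟩ | ⟨rfl, rfl, hab⟩
      · refine h_order_p _ hyP ?_
        rw [Nat.card_zpowers, hord]
        exact orderOf_eq_prime hxe hx1
      · have h4 : orderOf x ∣ 2 ^ 2 := orderOf_dvd_of_pow_eq_one hxe
        obtain ⟨j, hj, hj'⟩ := (Nat.dvd_prime_pow Nat.prime_two).1 h4
        -- When e = 4, x may have order 1, 2 or 4; order 2 falls under the hypothesis for order p.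
        interval_cases j
        · exact absurd (orderOf_eq_one_iff.1 hj') hx1
        · exact h_order_p _ hyP (by rw [Nat.card_zpowers, hord, hj', pow_one])
        · exact h_order_four rfl hab _ hyP inferInstance
            (by rw [Nat.card_zpowers, hord, hj']; norm_num)
  · intro U hUN hU
    rcases hcases with ⟨rfl, hab⟩ | ⟨h2, h4, -⟩
    · refine Or.inl ⟨rfl, fun h2 x hx y hy => ?_⟩
      obtain ⟨n, hn⟩ := hconj (U.subgroupOf N) hU.comap_subtype
      have h1 := hab h2 _ (hn ⟨x, hUN hx⟩ (Subgroup.mem_subgroupOf.2 hx))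
        _ (hn ⟨y, hUN hy⟩ (Subgroup.mem_subgroupOf.2 hy))
      have h3 : n * (⟨x, hUN hx⟩ * ⟨y, hUN hy⟩) * n⁻¹ =
          n * (⟨y, hUN hy⟩ * ⟨x, hUN hx⟩) * n⁻¹ := by
        simpa only [mul_assoc, inv_mul_cancel_left] using h1
      exact congrArg Subtype.val (mul_left_cancel (mul_right_cancel h3))
    · exact Or.inr ⟨h2, h4⟩
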